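/- Let $\mathfrak g$ be a complex simple Lie algebra with Killing form $\kappa$, $\mathfrak h$ a Cartan subalgebra, $\Delta$ its roots, $\Pi$ a system of simple roots, $\alpha_{\mathfrak q}\in\Pi$, and $H_{\mathfrak q}\in\mathfrak h$ the element such that $\beta(H_{\mathfrak q})$ is the multiplicity of $\alpha_{\mathfrak q}$ in $\beta$ for $\beta\in\Delta$. Let $\mathfrak g(j)$ be the $j$-eigenspace of $\operatorname{ad}(H_{\mathfrak q})$, $\mathfrak l=\mathfrak g(0)$, $\mathfrak n=\bigoplus_{j>0}\mathfrak g(j)$, $\bar{\mathfrak n}=\bigoplus_{j>0}\mathfrak g(-j)$, and let $\mathfrak q=\mathfrak l\oplus\mathfrak n$ be the maximal parabolic subalgebra determined by $\alpha_{\mathfrak q}$. Assume that $\mathfrak q$ is of quasi-Heisenberg type: $[\mathfrak n,[\mathfrak n,\mathfrak n]]=0$ and $\dim[\mathfrak n,\mathfrak n]>1$. Let $\mathfrak g_0$ be a real form of $\mathfrak g$ such that $\mathfrak q$ and $\bar{\mathfrak n}$ are the complexifications of $\mathfrak q\cap\mathfrak g_0$ and $\bar{\mathfrak n}_0=\bar{\mathfrak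 n}\cap\mathfrak g_0$, and let $\bar N_0$ be the unipotent group with Lie algebra $\bar{\mathfrak n}_0$. For $X\in\bar{\mathfrak n}_0$ let $(R(X)f)(\bar n)=\frac{d}{dt}f(\bar n\exp(tX))|_{t=0}$ on $C^\infty(\bar N_0)$ (complex-valued functions), extended $\mathbb C$-linearly to $X\in\bar{\mathfrak n}$. Let $\lambda_{\mathfrak q}$ be the fundamental weight of $\alpha_{\mathfrak q}$, regarded as a linear form on $\mathfrak q$ that vanishes on all root spaces. For $s\in\mathbb C$ let $\mathcal L_s$ be the trivial line bundle over $\bar N_0$ with the $\mathfrak g$-action on its space $C^\infty(\bar N_0)$ of smooth sections $$(\pi_s(Y)f)(\bar n)=s\,\lambda_{\mathfrak q}\big((\mathrm{Ad}(\bar n^{-1})Y)_{\mathfrak q}\big)f(\bar n)-\big(R\big((\mathrm{Ad}(\bar n^{-1})Y)_{\bar{\mathfrak n}}\big)f\big)(\bar n),\qquad Y\in\mathfrak g,$$ where the subscripts denote the components in $\mathfrak g=\bar{\mathfrak n}\oplus\mathfrak q$. A list $D_1,\dots,D_m$ of differential operators on $\mathcal L_s$ is a conformally invariant system on $\mathcal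 L_s$ if it is linearly independent at each point of $\bar N_0$ and if for each $Y\in\mathfrak g$ there is an $m\times m$ matrix $(C_{jk})$ of smooth functions with $[\pi_s(Y),D_k]=\sum_j C_{jk}D_j$ for all $k$. Two lists $D_k$ and $D_k'$ of length $m$ are equivalent if $D_k'=\sum_j A_{jk}D_j$ for some $A\in GL(m,C^\infty(\bar N_0))$. Let $W=\mathfrak g(-1)\otimes\mathfrak g(2)$, and let $\tau_1:\mathfrak g(1)\to W$, $\tau_1(X)=(\operatorname{ad}(X)\otimes\mathrm{Id})\omega$, with $\omega=\sum_\gamma X_\gamma^*\otimes X_\gamma$ for a basis $X_\gamma$ of $\mathfrak g(2)$ and its $\kappa$-dual basis $X_\gamma^*$ of $\mathfrak g(-2)$. For $Y^*\in W^*$ let $\tilde\tau_1(Y^*)(X)=Y^*(\tau_1(X))$, and let $\Omega_1(Y^*)=R(Z)$, where $Z\in\mathfrak g(-1)$ is the element with $\kappa(X,Z)=\tilde\tau_1(Y^*)(X)$ for all $X\in\mathfrak g(1)$. An $\Omega_1$ system on $\mathcal L_s$ is a list of differential operators on $\mathcal L_s$ that commute with $\pi_s(X)$ for all $X\in\bar{\mathfrak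 n}$ and that is equivalent to $\Omega_1(Y_1^*),\dots,\Omega_1(Y_n^*)$ for a basis $Y_1^*,\dots,Y_n^*$ of an irreducible $\mathfrak l$-submodule $V^*$ of $W^*$ with $\tilde\tau_1|_{V^*}\neq0$. Let $\Delta(\mathfrak g(1))=\{\alpha_1,\dots,\alpha_m\}$ be the set of the roots whose root space lies in $\mathfrak g(1)$, and let $X_{-\alpha_j}$ be a nonzero root vector for $-\alpha_j$. Then for every $s\in\mathbb C$ the list $R(X_{-\alpha_1}),\dots,R(X_{-\alpha_m})$ is an $\Omega_1$ system on $\mathcal L_s$; every $\Omega_1$ system on $\mathcal L_s$ is equivalent to it; and an $\Omega_1$ system on $\mathcal L_s$ is conformally invariant on $\mathcal L_s$ if and only if $s=0$. -/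

import Mathlib

open scoped TensorProduct ContDiff

noncomputable section

namespace OmegaOne

open LieAlgebra.IsKilling

/-! ### The grading of a simple Lie algebra attached to a simple root -/

section Grading

variable {𝔤 : Type*} [LieRing 𝔤] [LieAlgebra ℂ 𝔤] [FiniteDimensional ℂ 𝔤]
  [LieAlgebra.IsKilling ℂ 𝔤] {H : LieSubalgebra ℂ 𝔤} [H.IsCartanSubalgebra]
  (b : (rootSystem H).Base) (i : b.support)

/-- The element `H_q` of the Cartan subalgebra: `β(H_q)` is the multiplicity of the simple root
`α_q = i` in `β`, for every `β` in the dual of the Cartan subalgebra. -/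
def gradingElement : H := (Module.evalEquiv ℂ H).symm (b.toWeightBasis.coord i)

/-- The fundamental weight `λ_q` of the simple root `α_q = i`: it takes the value `1` on the coroot
of `α_q` and the value `0` on the other simple coroots. -/
def fundamentalWeight : Module.Dual ℂ H := b.toCoweightBasis.coord i

/-- `𝔤(j)`, the eigenspace of `ad H_q` for the eigenvalue `j`. -/
def gr (j : ℤ) : Submodule ℂ 𝔤 :=
  (LieAlgebra.ad ℂ 𝔤 (gradingElement b i : 𝔤)).eigenspace (j : ℂ)

/-- The nilpotent radical `𝔫 = ⨁_{j > 0} 𝔤(j)`. -/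
def nilradical : Submodule ℂ 𝔤 := ⨆ j : {j : ℤ // 0 < j}, gr b i j

/-- The opposite nilpotent radical `𝔫̄ = ⨁_{j > 0} 𝔤(-j)`. -/
def nilradicalOpp : Submodule ℂ 𝔤 := ⨆ j : {j : ℤ // j < 0}, gr b i j

/-- The maximal parabolic subalgebra `𝔮 = 𝔩 ⊕ 𝔫` of the simple root `i`, with Levi factor
`𝔩 = 𝔤(0)`. -/
def parabolic : Submodule ℂ 𝔤 := gr b i 0 ⊔ nilradical b i

/-- `𝔮` is of quasi-Heisenberg type: `[𝔫, [𝔫, 𝔫]] = 0` and `dim [𝔫, 𝔫] > 1`. -/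
structure IsQuasiHeisenberg : Prop where
  two_step : ∀ X ∈ nilradical b i, ∀ Y ∈ nilradical b i, ∀ Z ∈ nilradical b i,
    ⁅X, ⁅Y, Z⁆⁆ = 0
  one_lt_dim : 1 < Module.finrank ℂ (Submodule.span ℂ
    {W : 𝔤 | ∃ X ∈ nilradical b i, ∃ Y ∈ nilradical b i, W = ⁅X, Y⁆})

variable {b i}

lemma mem_gr {j : ℤ} {X : 𝔤} :
    X ∈ gr b i j ↔ ⁅(gradingElement b i : 𝔤), X⁆ = (j : ℂ) • X := by
  rw [gr, Module.End.mem_eigenspace_iff, LieAlgebra.ad_apply]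

lemma lie_mem_gr {j k : ℤ} {X Y : 𝔤} (hX : X ∈ gr b i j) (hY : Y ∈ gr b i k) :
    ⁅X, Y⁆ ∈ gr b i (j + k) := by
  rw [mem_gr] at *
  rw [leibniz_lie, hX, hY, smul_lie, lie_smul, ← add_smul]
  push_cast
  rfl

lemma apply_gradingElement (f : Module.Dual ℂ H) :
    f (gradingElement b i) = b.toWeightBasis.coord i f := by
  rw [← Module.Dual.eval_apply ℂ H (gradingElement b i) f, gradingElement,
    ← Module.evalEquiv_toLinearMap]
  simp

lemma exists_int_apply (χ : LieModule.Weight ℂ H 𝔤) :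
    ∃ j : ℤ, χ (gradingElement b i) = j := by
  classical
  by_cases hχ : χ.IsZero
  · refine ⟨0, ?_⟩
    rw [hχ]
    simp
  · have hmem : χ ∈ H.root := by simpa using hχ
    have h := b.root_mem_span_int ⟨χ, hmem⟩
    have key : ∀ v ∈ Submodule.span ℤ ((rootSystem H).root '' b.support),
        ∃ j : ℤ, v (gradingElement b i) = j := by
      intro v hv
      induction hv using Submodule.span_induction with
      | mem v hv =>
        obtain ⟨k, hk, rfl⟩ := hv
        refine ⟨if (⟨k, hk⟩ : b.support) = i then 1 else 0, ?_⟩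
        rw [apply_gradingElement, Module.Basis.coord_apply]
        have := b.toWeightBasis_repr_root ⟨k, hk⟩
        simp only at this
        rw [this, Finsupp.single_apply]
        split_ifs <;> simp
      | zero => exact ⟨0, by simp⟩
      | add v w _ _ hv hw =>
        obtain ⟨m, hm⟩ := hv
        obtain ⟨n, hn⟩ := hw
        exact ⟨m + n, by simp [hm, hn]⟩
      | smul n v _ hv =>
        obtain ⟨m, hm⟩ := hv
        exact ⟨n * m, by simp [hm]⟩
    obtain ⟨j, hj⟩ := key _ h
    exact ⟨j, by simpa using hj⟩

lemma iSup_gr_eq_top : ⨆ j : ℤ, gr b i j = ⊤ := by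
  have h := LieModule.iSup_genWeightSpace_eq_top' ℂ H 𝔤
  rw [eq_top_iff]
  have h2 : (⊤ : Submodule ℂ 𝔤) =
      ⨆ χ : LieModule.Weight ℂ H 𝔤, (LieModule.genWeightSpace 𝔤 χ).toSubmodule := by
    rw [← LieSubmodule.iSup_toSubmodule, h, LieSubmodule.top_toSubmodule]
  rw [h2]
  refine iSup_le fun χ => ?_
  obtain ⟨j, hj⟩ := exists_int_apply (b := b) (i := i) χ
  refine le_iSup_of_le j fun X hX => ?_
  rw [mem_gr, ← hj]
  exact lie_eq_smul_of_mem_rootSpace hX (gradingElement b i)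

lemma iSupIndep_gr : iSupIndep (gr b i) :=
  (Module.End.eigenspaces_iSupIndep _).comp (f := fun j : ℤ => (j : ℂ)) Int.cast_injective

lemma gr_le_nilradicalOpp {j : ℤ} (hj : j < 0) : gr b i j ≤ nilradicalOpp b i :=
  le_iSup (fun k : {j : ℤ // j < 0} => gr b i k) ⟨j, hj⟩

lemma gr_le_parabolic {j : ℤ} (hj : 0 ≤ j) : gr b i j ≤ parabolic b i := by
  rcases hj.eq_or_lt with rfl | hj
  · exact le_sup_left
  · exact (le_iSup (fun k : {j : ℤ // 0 < j} => gr b i k) ⟨j, hj⟩).trans le_sup_right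

variable (b i) in
/-- `𝔤 = 𝔫̄ ⊕ 𝔮`. -/
lemma isCompl_nilradicalOpp_parabolic : IsCompl (nilradicalOpp b i) (parabolic b i) := by
  constructor
  · have h1 : nilradicalOpp b i ≤ ⨆ j ∈ {j : ℤ | j < 0}, gr b i j := by
      rw [nilradicalOpp, iSup_subtype]
      exact le_rfl
    have h2 : parabolic b i ≤ ⨆ j ∈ {j : ℤ | 0 ≤ j}, gr b i j := by
      rw [parabolic, nilradical, iSup_subtype]
      refine sup_le (le_iSup₂_of_le 0 (le_refl (0 : ℤ)) le_rfl) (iSup₂_le fun j hj => ?_)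
      exact le_iSup₂_of_le j hj.le le_rfl
    refine (iSupIndep_gr.disjoint_biSup_biSup (Set.disjoint_left.mpr ?_)).mono h1 h2
    intro j hj hj'
    simp only [Set.mem_ofPred_eq] at hj hj'
    omega
  · rw [codisjoint_iff, eq_top_iff, ← iSup_gr_eq_top (b := b) (i := i)]
    refine iSup_le fun j => ?_
    rcases lt_or_ge j 0 with hj | hj
    · exact (gr_le_nilradicalOpp hj).trans le_sup_left
    · exact (gr_le_parabolic hj).trans le_sup_right

/-- Elements of `𝔫̄` are `ad`-nilpotent. -/
lemma isNilpotent_ad {X : 𝔤} (hX : X ∈ nilradicalOpp b i) :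
    IsNilpotent (LieAlgebra.ad ℂ 𝔤 X) := by
  -- only finitely many `𝔤(j)` are nonzero
  have hfin : {j : ℤ | gr b i j ≠ ⊥}.Finite := WellFoundedGT.finite_ne_bot_of_iSupIndep iSupIndep_gr
  obtain ⟨M, hM⟩ := hfin.bddAbove
  obtain ⟨m, hm⟩ := hfin.bddBelow
  let F : ℤ → Submodule ℂ 𝔤 := fun k => ⨆ j ∈ {j : ℤ | j ≤ k}, gr b i j
  have hF : ∀ k, ∀ Y ∈ F k, ⁅X, Y⁆ ∈ F (k - 1) := by
    intro k
    have : F k ≤ (F (k - 1)).comap (LieAlgebra.ad ℂ 𝔤 X) := by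
      refine iSup₂_le fun j hj Y hY => ?_
      rw [Submodule.mem_comap, LieAlgebra.ad_apply]
      have h2 : nilradicalOpp b i ≤ (F (k - 1)).comap (-LieAlgebra.ad ℂ 𝔤 Y) := by
        refine iSup_le fun l Z hZ => ?_
        rw [Submodule.mem_comap, LinearMap.neg_apply, LieAlgebra.ad_apply, lie_skew]
        have hl := l.2
        refine (le_iSup₂_of_le (l.1 + j) ?_ le_rfl : gr b i (l.1 + j) ≤ F (k - 1))
          (lie_mem_gr hZ hY)
        simp only [Set.mem_ofPred_eq] at hj ⊢
        omega
      have h3 := h2 hX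
      rwa [Submodule.mem_comap, LinearMap.neg_apply, LieAlgebra.ad_apply, lie_skew] at h3
    exact this
  have htop : F M = ⊤ := by
    rw [eq_top_iff, ← iSup_gr_eq_top (b := b) (i := i)]
    refine iSup_le fun j => ?_
    by_cases hj : gr b i j = ⊥
    · simp [hj]
    · exact le_iSup₂_of_le j (hM hj) le_rfl
  have hbot : ∀ k, k < m → F k = ⊥ := by
    intro k hk
    refine (eq_bot_iff.mpr <| iSup₂_le fun j hj => ?_)
    by_contra hne
    have h1 := hm (show j ∈ {j : ℤ | gr b i j ≠ ⊥} from fun h => hne h.le)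
    simp only [Set.mem_ofPred_eq] at hj
    omega
  have hpow : ∀ (n : ℕ) (Y : 𝔤), ((LieAlgebra.ad ℂ 𝔤 X) ^ n) Y ∈ F (M - n) := by
    intro n
    induction n with
    | zero => intro Y; simp [htop]
    | succ n ih =>
      intro Y
      rw [pow_succ', Module.End.mul_apply, LieAlgebra.ad_apply]
      have := hF _ _ (ih Y)
      rwa [show M - ((n + 1 : ℕ) : ℤ) = M - n - 1 by push_cast; ring]
  refine ⟨(M - m + 1).toNat, LinearMap.ext fun Y => ?_⟩
  have := hpow (M - m + 1).toNat Y
  rw [hbot _ (by omega), Submodule.mem_bot] at this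
  simpa using this

end Grading

/-! ### Smooth complex-valued functions on a finite-dimensional real vector space -/

section Smooth

variable {V : Type*} [AddCommGroup V] [Module ℝ V]

/-- A function on a (finite-dimensional) real vector space is smooth if it is `C^∞` in linear
coordinates. -/
def IsSmooth (F : V → ℂ) : Prop :=
  ∀ (d : ℕ) (φ : (Fin d → ℝ) →ₗ[ℝ] V), ContDiff ℝ ∞ fun v => F (φ v)

lemma IsSmooth.add {F G : V → ℂ} (hF : IsSmooth F) (hG : IsSmooth G) :
    IsSmooth fun v => F v + G v := fun d φ => (hF d φ).add (hG d φ)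

lemma IsSmooth.mul {F G : V → ℂ} (hF : IsSmooth F) (hG : IsSmooth G) :
    IsSmooth fun v => F v * G v := fun d φ => (hF d φ).mul (hG d φ)

lemma isSmooth_const (c : ℂ) : IsSmooth fun _ : V => c := fun _ _ => contDiff_const

lemma isSmooth_linear (ℓ : V →ₗ[ℝ] ℂ) : IsSmooth ℓ := fun _ φ =>
  (LinearMap.toContinuousLinearMap (ℓ ∘ₗ φ)).contDiff

/-- Differentiation of a smooth function along a vector field that is linear in the point. -/
lemma IsSmooth.exists_deriv [FiniteDimensional ℝ V] {F : V → ℂ} (hF : IsSmooth F) :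
    ∃ D : V → V →ₗ[ℝ] ℂ,
      (∀ T : V →ₗ[ℝ] V, IsSmooth fun v => D v (T v)) ∧
      ∀ (d : ℕ) (c : ℕ → V) (v B : V),
        HasDerivAt (fun t : ℝ => F (v + t • B + t ^ 2 • ∑ k ∈ Finset.range d, t ^ k • c k)) (D v B) 0 := by
  let e : (Fin (Module.finrank ℝ V) → ℝ) ≃ₗ[ℝ] V := (Module.finBasis ℝ V).equivFun.symm
  let G : (Fin (Module.finrank ℝ V) → ℝ) → ℂ := fun a => F (e a)
  have hG : ContDiff ℝ ∞ G := hF _ e.toLinearMap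
  refine ⟨fun v => (fderiv ℝ G (e.symm v)).toLinearMap ∘ₗ e.symm.toLinearMap, ?_, ?_⟩
  · intro T d φ
    have h1 : ContDiff ℝ ∞ fun a : Fin d → ℝ => e.symm (φ a) :=
      (LinearMap.toContinuousLinearMap (e.symm.toLinearMap ∘ₗ φ)).contDiff
    have h2 : ContDiff ℝ ∞ fun a : Fin d → ℝ => e.symm (T (φ a)) :=
      (LinearMap.toContinuousLinearMap (e.symm.toLinearMap ∘ₗ T ∘ₗ φ)).contDiff
    have h3 : ContDiff ℝ ∞ (fderiv ℝ G) := hG.fderiv_right (by simp)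
    exact (h3.comp h1).clm_apply h2
  · intro d c v B
    have hline : HasDerivAt (fun t : ℝ => e.symm v + t • e.symm B +
        t ^ 2 • ∑ k ∈ Finset.range d, t ^ k • e.symm (c k)) (e.symm B) 0 := by
      have hs : DifferentiableAt ℝ (fun t : ℝ => ∑ k ∈ Finset.range d, t ^ k • e.symm (c k)) 0 := by
        fun_prop
      have h1 := ((hasDerivAt_id (0 : ℝ)).smul_const (e.symm B)).const_add (e.symm v)
      have h2 := (hasDerivAt_pow 2 (0 : ℝ)).smul hs.hasDerivAt
      refine (h1.add h2).congr_deriv ?_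
      simp
    have hGd : HasFDerivAt G (fderiv ℝ G (e.symm v)) (e.symm v + (0 : ℝ) • e.symm B +
        (0 : ℝ) ^ 2 • ∑ k ∈ Finset.range d, (0 : ℝ) ^ k • e.symm (c k)) := by
      have : e.symm v + (0 : ℝ) • e.symm B +
        (0 : ℝ) ^ 2 • ∑ k ∈ Finset.range d, (0 : ℝ) ^ k • e.symm (c k) = e.symm v := by simp
      rw [this]
      exact (hG.differentiable (by simp) _).hasFDerivAt
    have := hGd.comp_hasDerivAt (0 : ℝ) hline
    refine this.congr_of_eventuallyEq (Filter.Eventually.of_forall fun t => ?_)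
    simp [G, map_sum]

end Smooth

/-! ### The exponential of a nilpotent endomorphism -/

section NilExp

variable {𝔤 : Type*} [AddCommGroup 𝔤] [Module ℂ 𝔤]

/-- The exponential of a nilpotent endomorphism of a finite-dimensional space; the exponential
series terminates before the dimension. -/
def nilExp (A : Module.End ℂ 𝔤) : Module.End ℂ 𝔤 :=
  ∑ k ∈ Finset.range (Module.finrank ℂ 𝔤), ((k.factorial : ℂ)⁻¹) • A ^ k

variable [FiniteDimensional ℂ 𝔤]

lemma pow_eq_zero_of_isNilpotent {A : Module.End ℂ 𝔤} (hA : IsNilpotent A) {k : ℕ}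
    (hk : Module.finrank ℂ 𝔤 ≤ k) : A ^ k = 0 := by
  have h := LinearMap.aeval_self_charpoly A
  rw [hA.charpoly_eq_X_pow_finrank, map_pow, Polynomial.aeval_X] at h
  exact pow_eq_zero_of_le hk h

lemma nilExp_eq_sum {A : Module.End ℂ 𝔤} (hA : IsNilpotent A) {n : ℕ}
    (hn : Module.finrank ℂ 𝔤 ≤ n) :
    nilExp A = ∑ k ∈ Finset.range n, ((k.factorial : ℂ)⁻¹) • A ^ k := by
  refine Finset.sum_subset (Finset.range_subset_range.mpr hn) fun k _ hk => ?_
  rw [pow_eq_zero_of_isNilpotent hA (by simpa using hk), smul_zero]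

lemma nilExp_mul_nilExp_neg {A : Module.End ℂ 𝔤} (hA : IsNilpotent A) :
    nilExp A * nilExp (-A) = 1 := by
  let _ : Module ℚ (Module.End ℂ 𝔤) := Module.compHom _ (algebraMap ℚ ℂ)
  have key : ∀ B : Module.End ℂ 𝔤, IsNilpotent B → nilExp B = IsNilpotent.exp B := by
    intro B hB
    rw [IsNilpotent.exp_eq_sum (pow_eq_zero_of_isNilpotent hB le_rfl), nilExp]
    refine Finset.sum_congr rfl fun k _ => ?_
    change _ = (algebraMap ℚ ℂ ((k.factorial : ℚ)⁻¹)) • B ^ k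
    simp
  rw [key A hA, key (-A) hA.neg, IsNilpotent.exp_mul_exp_neg_self hA]

lemma nilExp_neg_mul_nilExp {A : Module.End ℂ 𝔤} (hA : IsNilpotent A) :
    nilExp (-A) * nilExp A = 1 := by
  simpa using nilExp_mul_nilExp_neg hA.neg

end NilExp

/-! ### Real forms, the group `N̄₀`, and its smooth functions -/

section Group

variable {𝔤 : Type*} [LieRing 𝔤] [LieAlgebra ℂ 𝔤] [FiniteDimensional ℂ 𝔤]
  [LieAlgebra.IsKilling ℂ 𝔤] {H : LieSubalgebra ℂ 𝔤} [H.IsCartanSubalgebra]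

/-- A real form `𝔤₀` of `𝔤`, given by its conjugation (`𝔤₀` is the set of fixed points of the
conjugation), for which `𝔮` and `𝔫̄` are the complexifications of the real subalgebras `𝔮 ∩ 𝔤₀` and
`𝔫̄ ∩ 𝔤₀`. -/
structure RealForm (b : (rootSystem H).Base) (i : b.support) where
  /-- the conjugation of `𝔤` with respect to `𝔤₀` -/
  conj : 𝔤 →ₛₗ[starRingEnd ℂ] 𝔤
  conj_conj : ∀ X, conj (conj X) = X
  conj_lie : ∀ X Y, conj ⁅X, Y⁆ = ⁅conj X, conj Y⁆
  conj_parabolic : ∀ X ∈ parabolic b i, conj X ∈ parabolic b i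
  conj_nilradicalOpp : ∀ X ∈ nilradicalOpp b i, conj X ∈ nilradicalOpp b i

variable {b : (rootSystem H).Base} {i : b.support} (σ : RealForm b i)

lemma RealForm.conj_real_smul (c : ℝ) (X : 𝔤) : σ.conj (c • X) = c • σ.conj X := by
  have h1 : c • X = (c : ℂ) • X := rfl
  have h2 : c • σ.conj X = (c : ℂ) • σ.conj X := rfl
  rw [h1, h2, map_smulₛₗ, Complex.conj_ofReal]

/-- The real nilpotent Lie algebra `𝔫̄₀ = 𝔫̄ ∩ 𝔤₀`. -/
def realNilradicalOpp : Submodule ℝ 𝔤 where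
  carrier := {X | X ∈ nilradicalOpp b i ∧ σ.conj X = X}
  add_mem' := fun ha hb => ⟨add_mem ha.1 hb.1, by rw [map_add, ha.2, hb.2]⟩
  zero_mem' := ⟨zero_mem _, map_zero _⟩
  smul_mem' := fun c X hX => by
    exact ⟨Submodule.smul_of_tower_mem _ c hX.1, by rw [σ.conj_real_smul, hX.2]⟩

/-- The component `X₁ ∈ 𝔫̄₀` of `X = X₁ + √-1 X₂ ∈ 𝔫̄`. -/
def rePart : nilradicalOpp b i →ₗ[ℝ] realNilradicalOpp σ where
  toFun X := ⟨(2⁻¹ : ℝ) • ((X : 𝔤) + σ.conj X),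
    Submodule.smul_of_tower_mem _ _ (add_mem X.2 (σ.conj_nilradicalOpp _ X.2)), by
      rw [σ.conj_real_smul, map_add, σ.conj_conj, add_comm]⟩
  map_add' X Y := by
    ext
    simp only [Submodule.coe_add, map_add, ← smul_add]
    congr 1
    abel
  map_smul' c X := by
    ext
    change (2⁻¹ : ℝ) • (c • (X : 𝔤) + σ.conj (c • (X : 𝔤))) =
      c • (2⁻¹ : ℝ) • ((X : 𝔤) + σ.conj X)
    rw [σ.conj_real_smul, ← smul_add, smul_comm]

/-- The component `X₂ ∈ 𝔫̄₀` of `X = X₁ + √-1 X₂ ∈ 𝔫̄`. -/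
def imPart : nilradicalOpp b i →ₗ[ℝ] realNilradicalOpp σ where
  toFun X := rePart σ (-Complex.I • X)
  map_add' X Y := by rw [smul_add, map_add]
  map_smul' c X := by rw [smul_comm, map_smul, RingHom.id_apply]

/-- The exponential `exp (ad X)`, an automorphism of `𝔤`, for `X ∈ 𝔫̄₀`. -/
def expAd (X : realNilradicalOpp σ) : 𝔤 ≃ₗ[ℂ] 𝔤 :=
  LinearEquiv.ofLinearMap (nilExp (LieAlgebra.ad ℂ 𝔤 (X : 𝔤))) (nilExp (-LieAlgebra.ad ℂ 𝔤 (X : 𝔤)))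
    (nilExp_mul_nilExp_neg (isNilpotent_ad X.2.1))
    (nilExp_neg_mul_nilExp (isNilpotent_ad X.2.1))

/-- The unipotent group `N̄₀`, generated by the exponentials of the elements of `𝔫̄₀`. It is realized
in its adjoint action on `𝔤`, which is faithful: `Ad(n̄) Y` is `n̄ Y`. -/
def OppGroup : Subgroup (𝔤 ≃ₗ[ℂ] 𝔤) := Subgroup.closure (Set.range (expAd σ))

/-- The exponential map `𝔫̄₀ → N̄₀`. -/
def expN (X : realNilradicalOpp σ) : OppGroup σ :=
  ⟨expAd σ X, Subgroup.subset_closure ⟨X, rfl⟩⟩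

/-- The element `Ad(n̄)` of the vector space `End 𝔤`. -/
def toEnd (n : OppGroup σ) : Module.End ℂ 𝔤 := ((n : 𝔤 ≃ₗ[ℂ] 𝔤) : 𝔤 →ₗ[ℂ] 𝔤)

/-- The algebra `C^∞(N̄₀)` of smooth complex-valued functions on `N̄₀`. As `N̄₀` is a closed
submanifold of the real vector space `End 𝔤`, they are the restrictions of the smooth functions
on `End 𝔤`. -/
def SmoothFun : Subalgebra ℂ (OppGroup σ → ℂ) where
  carrier := {f | ∃ F : Module.End ℂ 𝔤 → ℂ, IsSmooth F ∧ ∀ n, f n = F (toEnd σ n)}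
  mul_mem' := by
    rintro f g ⟨F, hF, hf⟩ ⟨G, hG, hg⟩
    exact ⟨_, hF.mul hG, fun n => by rw [Pi.mul_apply, hf, hg]⟩
  add_mem' := by
    rintro f g ⟨F, hF, hf⟩ ⟨G, hG, hg⟩
    exact ⟨_, hF.add hG, fun n => by rw [Pi.add_apply, hf, hg]⟩
  algebraMap_mem' c := ⟨_, isSmooth_const c, fun n => rfl⟩

/-- `(R(X) f)(n̄) = d/dt f(n̄ exp(tX))` at `t = 0`, for `X ∈ 𝔫̄₀`. -/
def rightDeriv (X : realNilradicalOpp σ) (f : OppGroup σ → ℂ) (n : OppGroup σ) : ℂ :=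
  deriv (fun t : ℝ => f (n * expN σ (t • X))) 0

/-- The values of `R(X) f`, for `X ∈ 𝔫̄`: the `ℂ`-linear extension in `X` of `rightDeriv`. -/
def rightDerivC (X : nilradicalOpp b i) (f : OppGroup σ → ℂ) (n : OppGroup σ) : ℂ :=
  rightDeriv σ (rePart σ X) f n + Complex.I * rightDeriv σ (imPart σ X) f n

/-- Along `n̄ exp(tX)`, a smooth function is differentiated by differentiating an extension to
`End 𝔤` in the direction `Ad(n̄) ad X`. -/
lemma exists_rightDeriv {f : OppGroup σ → ℂ} (hf : f ∈ SmoothFun σ) :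
    ∃ D : Module.End ℂ 𝔤 → Module.End ℂ 𝔤 →ₗ[ℝ] ℂ,
      (∀ T : Module.End ℂ 𝔤 →ₗ[ℝ] Module.End ℂ 𝔤, IsSmooth fun v => D v (T v)) ∧
      ∀ (X : realNilradicalOpp σ) (n : OppGroup σ),
        HasDerivAt (fun t : ℝ => f (n * expN σ (t • X)))
          (D (toEnd σ n) (toEnd σ n * LieAlgebra.ad ℂ 𝔤 (X : 𝔤))) 0 := by
  obtain ⟨F, hF, hfF⟩ := hf
  obtain ⟨D, hD1, hD2⟩ := hF.exists_deriv
  refine ⟨D, hD1, fun X n => ?_⟩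
  set A : Module.End ℂ 𝔤 := LieAlgebra.ad ℂ 𝔤 (X : 𝔤) with hA
  have hnil : IsNilpotent A := isNilpotent_ad X.2.1
  refine (hD2 (Module.finrank ℂ 𝔤)
    (fun k => toEnd σ n * ((((k + 2).factorial : ℂ)⁻¹) • A ^ (k + 2)))
    (toEnd σ n) (toEnd σ n * A)).congr_of_eventuallyEq (Filter.Eventually.of_forall fun t => ?_)
  have h1 : toEnd σ (n * expN σ (t • X)) = toEnd σ n * nilExp (t • A) := by
    have h2 : LieAlgebra.ad ℂ 𝔤 ((t • X : realNilradicalOpp σ) : 𝔤) = t • A := by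
      ext Y
      change ⁅(t : ℂ) • (X : 𝔤), Y⁆ = (t : ℂ) • ⁅(X : 𝔤), Y⁆
      rw [smul_lie]
    rw [← h2]
    rfl
  have hnil' : IsNilpotent (t • A) := hnil.smul t
  simp only [hfF, h1]
  rw [nilExp_eq_sum hnil' (n := Module.finrank ℂ 𝔤 + 2) (by omega),
    Finset.sum_range_succ', Finset.sum_range_succ']
  congr 1
  have ht : ∀ (r : ℝ) (B : Module.End ℂ 𝔤), r • B = (r : ℂ) • B := fun r B => rfl
  simp only [ht, smul_pow, mul_add, Finset.mul_sum, Finset.smul_sum, Algebra.mul_smul_comm]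
  simp only [smul_smul, zero_add, pow_one, pow_zero, Nat.factorial_zero, Nat.factorial_one,
    Nat.cast_one, inv_one, one_mul, one_smul, mul_one]
  rw [add_comm (toEnd σ n), add_comm _ (∑ k ∈ _, _), ← add_assoc]
  congr 2
  refine Finset.sum_congr rfl fun k _ => ?_
  congr 1
  push_cast
  ring

lemma hasDerivAt_of_rightDeriv {f : OppGroup σ → ℂ} (hf : f ∈ SmoothFun σ)
    (X : realNilradicalOpp σ) (n : OppGroup σ) :
    HasDerivAt (fun t : ℝ => f (n * expN σ (t • X))) (rightDeriv σ X f n) 0 := by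
  obtain ⟨D, -, hD⟩ := exists_rightDeriv σ hf
  exact (hD X n).differentiableAt.hasDerivAt

lemma rightDeriv_add {f g : OppGroup σ → ℂ} (hf : f ∈ SmoothFun σ) (hg : g ∈ SmoothFun σ)
    (X : realNilradicalOpp σ) (n : OppGroup σ) :
    rightDeriv σ X (f + g) n = rightDeriv σ X f n + rightDeriv σ X g n :=
  ((hasDerivAt_of_rightDeriv σ hf X n).add (hasDerivAt_of_rightDeriv σ hg X n)).deriv

lemma rightDeriv_smul {f : OppGroup σ → ℂ} (hf : f ∈ SmoothFun σ) (c : ℂ)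
    (X : realNilradicalOpp σ) (n : OppGroup σ) :
    rightDeriv σ X (c • f) n = c * rightDeriv σ X f n :=
  ((hasDerivAt_of_rightDeriv σ hf X n).const_mul c).deriv

lemma rightDeriv_mem {f : OppGroup σ → ℂ} (hf : f ∈ SmoothFun σ) (X : realNilradicalOpp σ) :
    rightDeriv σ X f ∈ SmoothFun σ := by
  obtain ⟨D, hD1, hD2⟩ := exists_rightDeriv σ hf
  exact ⟨_, hD1 ((LinearMap.mulRight ℂ (LieAlgebra.ad ℂ 𝔤 (X : 𝔤))).restrictScalars ℝ),
    fun n => (hD2 X n).deriv⟩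

lemma rightDerivC_mem {f : OppGroup σ → ℂ} (hf : f ∈ SmoothFun σ) (X : nilradicalOpp b i) :
    rightDerivC σ X f ∈ SmoothFun σ :=
  add_mem (rightDeriv_mem σ hf _)
    (mul_mem (Subalgebra.algebraMap_mem _ Complex.I) (rightDeriv_mem σ hf _))

variable (𝔤) in
/-- `ad` as a linear map. -/
def adLin : 𝔤 →ₗ[ℂ] Module.End ℂ 𝔤 where
  toFun X := LieAlgebra.ad ℂ 𝔤 X
  map_add' X Y := map_add _ X Y
  map_smul' c X := map_smul _ c X

/-- `rightDerivC` is real linear in the direction. -/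
lemma rightDerivC_sum {f : OppGroup σ → ℂ} (hf : f ∈ SmoothFun σ) {κ : Type*} (s : Finset κ)
    (r : κ → ℝ) (X : κ → nilradicalOpp b i) (n : OppGroup σ) :
    rightDerivC σ (∑ k ∈ s, r k • X k) f n = ∑ k ∈ s, (r k : ℂ) * rightDerivC σ (X k) f n := by
  obtain ⟨D, -, hD⟩ := exists_rightDeriv σ hf
  have hlin : ∃ ℓ : realNilradicalOpp σ →ₗ[ℝ] ℂ, ∀ Z, rightDeriv σ Z f n = ℓ Z := by
    refine ⟨D (toEnd σ n) ∘ₗ (LinearMap.mulLeft ℂ (toEnd σ n)).restrictScalars ℝ ∘ₗ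
      ((adLin 𝔤).restrictScalars ℝ) ∘ₗ (realNilradicalOpp σ).subtype,
      fun Z => (hD Z n).deriv⟩
  obtain ⟨ℓ, hℓ⟩ := hlin
  simp only [rightDerivC, hℓ, map_sum, map_smul, Finset.mul_sum, ← Finset.sum_add_distrib]
  refine Finset.sum_congr rfl fun k _ => ?_
  simp only [Complex.real_smul]
  ring

/-- The right differentiation `R : 𝔫̄ → 𝔻(N̄₀)`, `(R(X) f)(n̄) = d/dt f(n̄ exp(tX))` at `t = 0`
for `X ∈ 𝔫̄₀`, extended `ℂ`-linearly to `𝔫̄`. -/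
def R (X : nilradicalOpp b i) : Module.End ℂ (SmoothFun σ) where
  toFun f := ⟨rightDerivC σ X f, rightDerivC_mem σ f.2 X⟩
  map_add' f g := by
    ext n
    change rightDerivC σ X ((f : OppGroup σ → ℂ) + g) n =
      rightDerivC σ X f n + rightDerivC σ X g n
    simp only [rightDerivC, rightDeriv_add σ f.2 g.2]
    ring
  map_smul' c f := by
    ext n
    change rightDerivC σ X (c • (f : OppGroup σ → ℂ)) n = c * rightDerivC σ X f n
    simp only [rightDerivC, rightDeriv_smul σ f.2]
    ring

/-- Elements of `N̄₀` preserve the Killing form. -/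
lemma killingForm_apply_left (n : OppGroup σ) (X Y : 𝔤) :
    killingForm ℂ 𝔤 ((n : 𝔤 ≃ₗ[ℂ] 𝔤) X) Y =
      killingForm ℂ 𝔤 X ((n : 𝔤 ≃ₗ[ℂ] 𝔤)⁻¹ Y) := by
  obtain ⟨n, hn⟩ := n
  change killingForm ℂ 𝔤 (n X) Y = killingForm ℂ 𝔤 X (n⁻¹ Y)
  induction hn using Subgroup.closure_induction generalizing X Y with
  | mem g hg =>
    obtain ⟨Z, rfl⟩ := hg
    change killingForm ℂ 𝔤 (nilExp _ X) Y = killingForm ℂ 𝔤 X (nilExp _ Y)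
    have hk : ∀ (k : ℕ) (X : 𝔤), killingForm ℂ 𝔤 ((LieAlgebra.ad ℂ 𝔤 (Z : 𝔤) ^ k) X) Y =
        killingForm ℂ 𝔤 X (((-LieAlgebra.ad ℂ 𝔤 (Z : 𝔤)) ^ k) Y) := by
      intro k
      induction k with
      | zero => intro X; simp
      | succ k ih =>
        intro X
        rw [pow_succ, Module.End.mul_apply, ih, pow_succ', Module.End.mul_apply,
          LieAlgebra.ad_apply, LinearMap.neg_apply, LieAlgebra.ad_apply, map_neg,
          ← lie_skew, map_neg, LinearMap.neg_apply, LieModule.traceForm_apply_lie_apply]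
    simp only [nilExp, LinearMap.sum_apply, map_sum, LinearMap.smul_apply, map_smul, hk]
  | one => rfl
  | mul g h _ _ hg hh =>
    rw [LinearEquiv.mul_apply, hg, hh, mul_inv_rev, LinearEquiv.mul_apply]
  | inv g _ hg =>
    rw [inv_inv, LieModule.traceForm_comm, ← hg, LieModule.traceForm_comm]

/-- The extension of the fundamental weight `λ_q` to `𝔤` by `0` on all root spaces, written as
`Y ↦ κ(H_λ, Y)`, where `H_λ` in the Cartan subalgebra represents `λ_q` with respect to the Killing
form `κ`. Its restriction to `𝔮` is the differential of the character `χ_q`. -/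
def fundamentalWeightExt (b : (rootSystem H).Base) (i : b.support) : Module.Dual ℂ 𝔤 :=
  killingForm ℂ 𝔤 ((cartanEquivDual H).symm (fundamentalWeight b i) : H)

/-- The component `Y_𝔫̄` of `Y` in `𝔤 = 𝔫̄ ⊕ 𝔮`. -/
def projOpp (b : (rootSystem H).Base) (i : b.support) : 𝔤 →ₗ[ℂ] nilradicalOpp b i :=
  (nilradicalOpp b i).projectionOnto (parabolic b i) (isCompl_nilradicalOpp_parabolic b i)

/-- The component `Y_𝔮` of `Y` in `𝔤 = 𝔫̄ ⊕ 𝔮`. -/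
def projParabolic (b : (rootSystem H).Base) (i : b.support) : 𝔤 →ₗ[ℂ] parabolic b i :=
  (parabolic b i).projectionOnto (nilradicalOpp b i) (isCompl_nilradicalOpp_parabolic b i).symm

/-- `Ad(n̄⁻¹) Y` depends linearly on `Ad(n̄)`. -/
lemma exists_linear_inv_apply (Y : 𝔤) :
    ∃ L : Module.End ℂ 𝔤 →ₗ[ℝ] 𝔤, ∀ n : OppGroup σ, (n : 𝔤 ≃ₗ[ℂ] 𝔤)⁻¹ Y = L (toEnd σ n) := by
  let κ := LinearMap.BilinForm.toDual (killingForm ℂ 𝔤)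
    (LieAlgebra.IsKilling.killingForm_nondegenerate ℂ 𝔤)
  let L : Module.End ℂ 𝔤 →ₗ[ℂ] 𝔤 := κ.symm.toLinearMap ∘ₗ
    LinearMap.llcomp ℂ 𝔤 𝔤 ℂ (killingForm ℂ 𝔤 Y)
  refine ⟨L.restrictScalars ℝ, fun n => κ.injective ?_⟩
  change κ _ = κ (κ.symm _)
  rw [LinearEquiv.apply_symm_apply]
  ext X
  change killingForm ℂ 𝔤 _ X = killingForm ℂ 𝔤 Y ((n : 𝔤 ≃ₗ[ℂ] 𝔤) X)
  rw [LieModule.traceForm_comm, ← killingForm_apply_left, LieModule.traceForm_comm]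

/-- The values of `π_s(Y) f`:
`(π_s(Y) f)(n̄) = s λ_q((Ad(n̄⁻¹) Y)_𝔮) f(n̄) - (R((Ad(n̄⁻¹) Y)_𝔫̄) f)(n̄)`. -/
def lineBundleActionFun (s : ℂ) (Y : 𝔤) (f : OppGroup σ → ℂ) (n : OppGroup σ) : ℂ :=
  s * fundamentalWeightExt b i (projParabolic b i ((n : 𝔤 ≃ₗ[ℂ] 𝔤)⁻¹ Y)) * f n -
    rightDerivC σ (projOpp b i ((n : 𝔤 ≃ₗ[ℂ] 𝔤)⁻¹ Y)) f n

lemma lineBundleActionFun_mem (s : ℂ) (Y : 𝔤) {f : OppGroup σ → ℂ} (hf : f ∈ SmoothFun σ) :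
    lineBundleActionFun σ s Y f ∈ SmoothFun σ := by
  obtain ⟨L, hL⟩ := exists_linear_inv_apply σ Y
  have h1 : (fun n : OppGroup σ =>
      s * fundamentalWeightExt b i (projParabolic b i ((n : 𝔤 ≃ₗ[ℂ] 𝔤)⁻¹ Y))) ∈ SmoothFun σ := by
    refine ⟨_, (isSmooth_const s).mul (isSmooth_linear
      (((fundamentalWeightExt b i) ∘ₗ (parabolic b i).subtype ∘ₗ
        projParabolic b i).restrictScalars ℝ ∘ₗ L)), fun n => ?_⟩
    simp only [hL]
    rfl
  let B := Module.finBasis ℝ (nilradicalOpp b i)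
  have h2 : (fun n : OppGroup σ => rightDerivC σ (projOpp b i ((n : 𝔤 ≃ₗ[ℂ] 𝔤)⁻¹ Y)) f n) =
      ∑ k, (fun n : OppGroup σ => ((B.repr (projOpp b i ((n : 𝔤 ≃ₗ[ℂ] 𝔤)⁻¹ Y)) k : ℝ) : ℂ)) *
        rightDerivC σ (B k) f := by
    funext n
    conv_lhs => rw [← B.sum_repr (projOpp b i ((n : 𝔤 ≃ₗ[ℂ] 𝔤)⁻¹ Y)), rightDerivC_sum σ hf]
    rw [Finset.sum_apply]
    rfl
  refine sub_mem (mul_mem h1 hf) ?_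
  rw [h2]
  refine sum_mem fun k _ => mul_mem ?_ (rightDerivC_mem σ hf _)
  refine ⟨_, isSmooth_linear (Complex.ofRealCLM.toLinearMap ∘ₗ B.coord k ∘ₗ
    (projOpp b i).restrictScalars ℝ ∘ₗ L), fun n => ?_⟩
  simp only [hL]
  rfl

/-- The action `π_s` of `𝔤` on the smooth sections of the line bundle `𝓛_s` over `N̄₀`. The bundle is
trivial over `N̄₀`, its sections are the functions `f ∈ C^∞(N̄₀)`, and `π_s` is the `ℂ`-linearly
extended differential of the left translation of the functions
`F(n̄ q) = χ^s(q)⁻¹ f(n̄)` on `N̄₀ Q₀`. -/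
def lineBundleAction (s : ℂ) (Y : 𝔤) : Module.End ℂ (SmoothFun σ) where
  toFun f := ⟨lineBundleActionFun σ s Y f, lineBundleActionFun_mem σ s Y f.2⟩
  map_add' f g := by
    ext n
    have h := congrArg (fun u : SmoothFun σ => (u : OppGroup σ → ℂ) n)
      (map_add (R σ (projOpp b i ((n : 𝔤 ≃ₗ[ℂ] 𝔤)⁻¹ Y))) f g)
    change rightDerivC σ _ ((f : OppGroup σ → ℂ) + g) n =
      rightDerivC σ _ f n + rightDerivC σ _ g n at h
    change lineBundleActionFun σ s Y ((f : OppGroup σ → ℂ) + g) n =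
      lineBundleActionFun σ s Y f n + lineBundleActionFun σ s Y g n
    simp only [lineBundleActionFun, h, Pi.add_apply]
    ring
  map_smul' c f := by
    ext n
    have h := congrArg (fun u : SmoothFun σ => (u : OppGroup σ → ℂ) n)
      (map_smul (R σ (projOpp b i ((n : 𝔤 ≃ₗ[ℂ] 𝔤)⁻¹ Y))) c f)
    change rightDerivC σ _ (c • (f : OppGroup σ → ℂ)) n = c * rightDerivC σ _ f n at h
    change lineBundleActionFun σ s Y (c • (f : OppGroup σ → ℂ)) n =
      c * lineBundleActionFun σ s Y f n
    simp only [lineBundleActionFun, h, Pi.smul_apply, smul_eq_mul]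
    ring

end Group

/-! ### Differential operators and conformally invariant systems -/

section Systems

variable {𝔤 : Type*} [LieRing 𝔤] [LieAlgebra ℂ 𝔤] [FiniteDimensional ℂ 𝔤]
  [LieAlgebra.IsKilling ℂ 𝔤] {H : LieSubalgebra ℂ 𝔤} [H.IsCartanSubalgebra]
  {b : (rootSystem H).Base} {i : b.support} (σ : RealForm b i)

/-- Linear operators on `C^∞(N̄₀)`. -/
abbrev Op : Type _ := Module.End ℂ (SmoothFun σ)

variable {σ}

/-- Multiplication by a smooth function. -/
def mulOp (f : SmoothFun σ) : Op σ := LinearMap.mulLeft ℂ f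

/-- The commutator `[D, E] = D E - E D`. -/
def comm (D E : Op σ) : Op σ := D * E - E * D

/-- Differential operators of order at most `k`: those of order at most `0` commute with all
multiplication operators, and `D` has order at most `k + 1` if all its commutators with
multiplication operators have order at most `k`. -/
def IsDiffOpOfOrder : ℕ → Op σ → Prop
  | 0, D => ∀ f : SmoothFun σ, comm D (mulOp f) = 0
  | k + 1, D => ∀ f : SmoothFun σ, IsDiffOpOfOrder k (comm D (mulOp f))

/-- `D` belongs to the algebra `𝔻(𝓛_s)` of differential operators. -/
def IsDiffOp (D : Op σ) : Prop := ∃ k, IsDiffOpOfOrder k D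

/-- The linear functional `D_p : f ↦ (D f)(p)`. -/
def evalAt (p : OppGroup σ) (D : Op σ) : SmoothFun σ →ₗ[ℂ] ℂ where
  toFun f := (D f : OppGroup σ → ℂ) p
  map_add' f g := by rw [map_add]; rfl
  map_smul' c f := by rw [map_smul]; rfl

/-- `D₁, …, D_m` is a conformally invariant system on `𝓛_s`. -/
structure IsConformallyInvariantSystem (s : ℂ) {m : ℕ} (D : Fin m → Op σ) : Prop where
  isDiffOp : ∀ j, IsDiffOp (D j)
  linearIndependent : ∀ p : OppGroup σ, LinearIndependent ℂ fun j => evalAt p (D j)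
  exists_structure_operator : ∀ Y : 𝔤, ∃ C : Matrix (Fin m) (Fin m) (SmoothFun σ),
    ∀ j, comm (lineBundleAction σ s Y) (D j) = ∑ k, mulOp (C k j) * D k

/-- Equivalence of two systems of differential operators: `D'_j = ∑ₖ A_{kj} D_k` for an invertible
matrix `A` of smooth functions. -/
def SystemEquiv {m : ℕ} (D D' : Fin m → Op σ) : Prop :=
  ∃ A : GL (Fin m) (SmoothFun σ), ∀ j, D' j =
    ∑ k, mulOp ((A : Matrix (Fin m) (Fin m) (SmoothFun σ)) k j) * D k

end Systems

/-! ### The `Ω₁` system -/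

section OmegaOne

variable {𝔤 : Type*} [LieRing 𝔤] [LieAlgebra ℂ 𝔤] [FiniteDimensional ℂ 𝔤]
  [LieAlgebra.IsKilling ℂ 𝔤] {H : LieSubalgebra ℂ 𝔤} [H.IsCartanSubalgebra]
  (b : (rootSystem H).Base) (i : b.support)

/-- The Levi subalgebra `𝔩 = 𝔤(0)`. -/
def levi : LieSubalgebra ℂ 𝔤 where
  toSubmodule := gr b i 0
  lie_mem' := fun {X Y} hX hY => by
    have h : ⁅X, Y⁆ ∈ gr b i (0 + 0) := lie_mem_gr hX hY
    rwa [add_zero] at h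

/-- `𝔤(j)` as an `𝔩`-module under the adjoint action. -/
def grMod (j : ℤ) : LieSubmodule ℂ (levi b i) 𝔤 where
  toSubmodule := gr b i j
  lie_mem := fun {x Y} hY => by
    have h : ⁅(x : 𝔤), Y⁆ ∈ gr b i (0 + j) := lie_mem_gr x.2 hY
    rwa [zero_add] at h

/-- The pairing `𝔤(-j) × 𝔤(j) → ℂ` given by the Killing form. -/
def killingPairing (j : ℤ) : grMod b i (-j) →ₗ[ℂ] grMod b i j →ₗ[ℂ] ℂ :=
  (killingForm ℂ 𝔤).compl₁₂ (grMod b i (-j)).toSubmodule.subtype (grMod b i j).toSubmodule.subtype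

lemma killingForm_eq_zero {j k : ℤ} (hjk : j + k ≠ 0) {X Y : 𝔤} (hX : X ∈ gr b i j)
    (hY : Y ∈ gr b i k) : killingForm ℂ 𝔤 X Y = 0 := by
  rw [mem_gr] at hX hY
  have h := LieModule.traceForm_apply_lie_apply ℂ 𝔤 𝔤 X (gradingElement b i : 𝔤) Y
  rw [← lie_skew, hX, hY, map_neg, map_smul, map_smul, LinearMap.neg_apply,
    LinearMap.smul_apply, smul_eq_mul, smul_eq_mul] at h
  have h2 : ((j + k : ℤ) : ℂ) * killingForm ℂ 𝔤 X Y = 0 := by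
    push_cast
    linear_combination -h
  rcases mul_eq_zero.mp h2 with h3 | h3
  · exact absurd (by exact_mod_cast h3) hjk
  · exact h3

lemma eq_zero_of_killingForm {j : ℤ} {X : 𝔤} (hX : X ∈ gr b i j)
    (h : ∀ Y ∈ gr b i (-j), killingForm ℂ 𝔤 X Y = 0) : X = 0 := by
  have hker : ⨆ k, gr b i k ≤ LinearMap.ker (killingForm ℂ 𝔤 X) := by
    refine iSup_le fun k Y hY => ?_
    rw [LinearMap.mem_ker]
    by_cases hjk : j + k = 0
    · obtain rfl : k = -j := by omega
      exact h Y hY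
    · exact killingForm_eq_zero b i hjk hX hY
  rw [iSup_gr_eq_top] at hker
  exact (LieAlgebra.IsKilling.killingForm_nondegenerate ℂ 𝔤).1 X fun Y => hker Submodule.mem_top

instance (j : ℤ) : (killingPairing b i j).IsPerfPair := by
  refine LinearMap.IsPerfPair.of_injective ?_ ?_
  · rw [injective_iff_map_eq_zero]
    intro X hX
    refine Subtype.ext (eq_zero_of_killingForm b i X.2 fun Y hY => ?_)
    rw [neg_neg] at hY
    exact LinearMap.congr_fun hX ⟨Y, hY⟩
  · rw [injective_iff_map_eq_zero]
    intro X hX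
    refine Subtype.ext (eq_zero_of_killingForm b i X.2 fun Y hY => ?_)
    rw [LieModule.traceForm_comm]
    exact LinearMap.congr_fun hX ⟨Y, hY⟩

/-- The isomorphism of `𝔤(-j)` with the dual space of `𝔤(j)` given by the Killing form. -/
def killingEquiv (j : ℤ) : grMod b i (-j) ≃ₗ[ℂ] Module.Dual ℂ (grMod b i j) :=
  (killingPairing b i j).toPerfPair

/-- The element `ω = ∑_γ X_γ^* ⊗ X_γ` of `𝔤(-2) ⊗ 𝔤(2)`, for a basis `X_γ` of `𝔤(2)` and its dual
basis `X_γ^*` of `𝔤(-2)` with respect to the Killing form. -/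
def omega : grMod b i (-2) ⊗[ℂ] grMod b i 2 :=
  ∑ k, (killingEquiv b i 2).symm ((Module.finBasis ℂ (grMod b i 2)).coord k) ⊗ₜ[ℂ]
    Module.finBasis ℂ (grMod b i 2) k

/-- The bracket `𝔤(1) × 𝔤(-2) → 𝔤(-1)`, `(X, Z) ↦ ad(X) Z`. -/
def adOne : grMod b i 1 →ₗ[ℂ] grMod b i (-2) →ₗ[ℂ] grMod b i (-1) :=
  LinearMap.mk₂ ℂ
    (fun X Z => ⟨⁅(X : 𝔤), (Z : 𝔤)⁆, by
      have h : ⁅(X : 𝔤), (Z : 𝔤)⁆ ∈ gr b i (1 + -2) := lie_mem_gr X.2 Z.2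
      rwa [show (1 + -2 : ℤ) = -1 by norm_num] at h⟩)
    (fun X X' Z => Subtype.ext (add_lie (X : 𝔤) (X' : 𝔤) (Z : 𝔤)))
    (fun c X Z => Subtype.ext (smul_lie c (X : 𝔤) (Z : 𝔤)))
    (fun X Z Z' => Subtype.ext (lie_add (X : 𝔤) (Z : 𝔤) (Z' : 𝔤)))
    (fun c X Z => Subtype.ext (lie_smul c (X : 𝔤) (Z : 𝔤)))

/-- The `𝔩`-module `W = 𝔤(-1) ⊗ 𝔤(2)`. -/
abbrev W : Type _ := grMod b i (-1) ⊗[ℂ] grMod b i 2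

/-- The covariant map `τ₁ : 𝔤(1) → 𝔤(-1) ⊗ 𝔤(2)`, `τ₁(X) = (ad(X) ⊗ Id) ω`. -/
def tauOne : grMod b i 1 →ₗ[ℂ] W b i where
  toFun X := (adOne b i X).rTensor (grMod b i 2) (omega b i)
  map_add' X Y := by rw [map_add, LinearMap.rTensor_add, LinearMap.add_apply]
  map_smul' c X := by rw [map_smul, LinearMap.rTensor_smul, LinearMap.smul_apply]; rfl

/-- `τ̃₁(Y^*) : X ↦ Y^*(τ₁(X))`, a linear form on `𝔤(1)`, for `Y^* ∈ W^*`. -/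
def tauTildeOne (Y : Module.Dual ℂ (W b i)) : Module.Dual ℂ (grMod b i 1) := Y ∘ₗ tauOne b i

/-- The inclusion of `𝔤(-1)` in `𝔫̄`. -/
def inclOpp (X : grMod b i (-1)) : nilradicalOpp b i :=
  ⟨X, gr_le_nilradicalOpp (by norm_num) X.2⟩

variable {b i} (σ : RealForm b i)

/-- The first order differential operator `Ω₁(Y^*)`: the linear form `τ̃₁(Y^*)` on `𝔤(1)` is
identified with an element of `𝔤(-1) ⊆ 𝔫̄` by the Killing form, which acts by right
differentiation. -/
def Omega (Y : Module.Dual ℂ (W b i)) : Op σ :=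
  R σ (inclOpp b i ((killingEquiv b i 1).symm (tauTildeOne b i Y)))

/-- `D₁, …, D_m` is an `Ω₁` system on `𝓛_s`: the `D_j` are differential operators that commute with
the action of `𝔫̄`, and the list is equivalent to `Ω₁(Y₁^*), …, Ω₁(Y_m^*)` for a basis `Y_j^*` of an
irreducible constituent `V^*` of the `𝔩`-module `𝔤(-1)^* ⊗ 𝔤(2)^* = W^*` with `τ̃₁|_{V^*} ≠ 0`. -/
def IsOmegaOneSystem (s : ℂ) {m : ℕ} (D : Fin m → Op σ) : Prop :=
  (∀ j, IsDiffOp (D j) ∧ ∀ X ∈ nilradicalOpp b i, comm (lineBundleAction σ s X) (D j) = 0) ∧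
  ∃ V : LieSubmodule ℂ (levi b i) (Module.Dual ℂ (W b i)),
    LieModule.IsIrreducible ℂ (levi b i) V ∧
    (∃ Y ∈ V, tauTildeOne b i Y ≠ 0) ∧
    ∃ Y : Module.Basis (Fin m) ℂ V, SystemEquiv (fun j => Omega σ (Y j)) D

variable (b i) in
/-- `Δ(𝔤(1))`, the set of the roots whose root space lies in `𝔤(1)`. -/
def DeltaOne : Type _ :=
  {α : LieModule.Weight ℂ H 𝔤 //
    α.IsNonZero ∧ (LieAlgebra.rootSpace H α).toSubmodule ≤ gr b i 1}

end OmegaOne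

end OmegaOne

end

/-!
The proof rests on two facts: `𝔤(-1)` is an irreducible `𝔩`-module, and the operators `π_0(Y)` and
`R(Z)` on `C^∞(N̄₀)` satisfy the commutator formula `[π_0(Y), R(Z)] = -R([Z, (Ad(n̄⁻¹) Y)_𝔮]_𝔫̄)`.

*Irreducibility.* Every positive root is reached from the simple roots by adding one simple root at
a time, and `[𝔤_α, 𝔤_β] = 𝔤_{α + β}` for roots; hence `𝔤(±1)` is generated over `𝔩` by the root
space of `±α_q` (`gr_le_of_generators`). An `𝔩`-submodule of `𝔤(-1)` either contains
`𝔤_{-α_q}`, or is Killing-orthogonal to `𝔤_{α_q}`, hence to `𝔤(1)`, hence zero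
(`eq_bot_or_eq_gr_neg_one`).

*The `Ω₁` systems.* Dualizing by the Killing form, `τ̃₁` becomes an `𝔩`-homomorphism
`omegaHom : W^* → 𝔤(-1)` with `Ω₁(Y^*) = R(omegaHom Y^*)`. By Schur's lemma it maps every irreducible
submodule of `W^*` on which it does not vanish isomorphically to `𝔤(-1)` (`omegaEquiv`), so every
`Ω₁` system is equivalent, by a constant matrix, to the right differentiations along any basis of
`𝔤(-1)`. Such a submodule exists: the transpose of the bracket `𝔤(-1) ⊗ 𝔤(2) → 𝔤(1)` embeds `𝔤(-1)`
in `W^*`, and its composition with `omegaHom` is the action of `S = ∑ [X_γ^*, X_γ]` up to sign. This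
`S` is central in `𝔩`, hence a multiple of `H_q`, and it is nonzero because
`κ(H_q, S) = -2 dim 𝔤(2)`. The hypothesis on `𝔮` enters through `[𝔤(2), 𝔤(1)] = 0` and `𝔤(2) ≠ 0`.

*Conformal invariance.* For `Z ∈ 𝔤(-1)` the vector `[Z, y_𝔮]_𝔫̄` lies in `𝔤(-1)` again, so the
commutator formula provides the structure operators when `s = 0`. Conversely, the operators of an
`Ω₁` system annihilate the constant `1`; if the system is conformally invariant they also annihilate
`π_s(Y) 1`, which is `s` times the function `n̄ ↦ λ_q(Ad(n̄⁻¹) Y)`. Differentiating that function at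
the identity along a root vector of `-α_q` gives `s (λ_q, α_q) = 0` up to nonzero factors, whence
`s = 0` (`eq_zero_of_isConformallyInvariantSystem`).
-/

noncomputable section

namespace OmegaOne

open LieAlgebra.IsKilling LieModule LieAlgebra

/-! ### Brackets of root spaces and generation of the graded pieces -/

section Roots

variable {𝔤 : Type*} [LieRing 𝔤] [LieAlgebra ℂ 𝔤] [FiniteDimensional ℂ 𝔤]
  [LieAlgebra.IsKilling ℂ 𝔤] {H : LieSubalgebra ℂ 𝔤} [H.IsCartanSubalgebra]

/-- If `α` and `α + β` are roots and `β` is a root or zero, then `[𝔤_α, 𝔤_β] ≠ 0`: in the irreducible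
`𝔰𝔩₂`-module generated by the top of the `α`-string through `α + β`, the raising operator kills
nothing below the top. -/
lemma exists_lie_ne_zero {α β γ : Weight ℂ H 𝔤} (hα : α.IsNonZero)
    (hγ : (γ : H → ℂ) = α + β) :
    ∃ e ∈ rootSpace H α, ∃ x ∈ rootSpace H β, ⁅e, x⁆ ≠ 0 := by
  obtain ⟨h, e, f, ht, he, hf⟩ := exists_isSl2Triple_of_weight_isNonZero hα
  have hα' : (α : H → ℂ) ≠ 0 := hα
  obtain ⟨m, hm, hm0⟩ := (chainTop (α : H → ℂ) γ).exists_ne_zero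
  have P : ht.HasPrimitiveVectorWith m (chainLength α γ : ℂ) := by
    refine ⟨hm0, ?_, ?_⟩
    · rw [ht.h_eq_coroot hα he hf, chainLength_smul α γ hm]
      rfl
    · have h1 := lie_mem_genWeightSpace_of_mem_genWeightSpace he hm
      rwa [genWeightSpace_add_chainTop _ _ hα', LieSubmodule.mem_bot] at h1
  have hmem : ∀ n : ℕ, ((LieModule.toEnd ℂ 𝔤 𝔤 f) ^ n) m ∈
      rootSpace H (-(n : ℤ) • (α : H → ℂ) + chainTop (α : H → ℂ) γ) := by
    intro n
    induction n with
    | zero => simpa using hm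
    | succ n ih =>
      rw [pow_succ', Module.End.mul_apply, LieModule.toEnd_apply_apply]
      have h1 := lie_mem_genWeightSpace_of_mem_genWeightSpace hf ih
      convert h1 using 2
      push_cast
      module
  -- `f ^ n` does not kill the top vector as long as `n` does not exceed the length of the string:
  -- `e (f ^ (n + 1) m) = (n + 1) (chainLength - n) f ^ n m`.
  have hne : ∀ n : ℕ, n ≤ chainLength α γ → ((LieModule.toEnd ℂ 𝔤 𝔤 f) ^ n) m ≠ 0 := by
    intro n
    induction n with
    | zero => intro _; simpa using hm0
    | succ n ih =>
      intro hn h0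
      have h1 := P.lie_e_pow_succ_toEnd_f n
      rw [h0, lie_zero, eq_comm, smul_eq_zero] at h1
      refine h1.elim (fun h2 => ?_) (ih (by omega))
      rcases mul_eq_zero.mp h2 with h3 | h3
      · exact Nat.cast_add_one_ne_zero n h3
      · rw [sub_eq_zero] at h3
        have : chainLength α γ = n := by exact_mod_cast h3
        omega
  -- `β` is a weight of the string, so the string does not end at `α + β`.
  have hbot : 1 ≤ chainBotCoeff (α : H → ℂ) γ := by
    have h1 := le_chainBotCoeff_of_rootSpace_ne_top α γ hα 1 (by
      rw [hγ, show (-1 : ℤ) • (α : H → ℂ) + (α + β) = β by module]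
      exact β.2)
    exact_mod_cast h1
  have hlen := chainBotCoeff_add_chainTopCoeff α γ
  refine ⟨e, he, ((LieModule.toEnd ℂ 𝔤 𝔤 f) ^ (chainTopCoeff (α : H → ℂ) γ + 1)) m, ?_, ?_⟩
  · convert hmem (chainTopCoeff (α : H → ℂ) γ + 1) using 2
    rw [coe_chainTop, hγ]
    push_cast
    module
  · rw [P.lie_e_pow_succ_toEnd_f]
    refine smul_ne_zero (mul_ne_zero (Nat.cast_add_one_ne_zero _) ?_) (hne _ (by omega))
    rw [sub_ne_zero]
    exact_mod_cast (by omega : chainLength α γ ≠ chainTopCoeff (α : H → ℂ) γ)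

lemma rootSpace_le_of_mem {γ : Weight ℂ H 𝔤} (hγ : γ.IsNonZero) {z : 𝔤} (hz : z ∈ rootSpace H γ)
    (hz0 : z ≠ 0) {M : Submodule ℂ 𝔤} (hM : z ∈ M) : (rootSpace H γ).toSubmodule ≤ M := by
  intro y hy
  obtain ⟨c, hc⟩ := (finrank_eq_one_iff_of_nonzero' (⟨z, hz⟩ : rootSpace H γ)
    (fun h => hz0 (congrArg Subtype.val h))).mp (finrank_rootSpace_eq_one γ hγ) ⟨y, hy⟩
  have : y = c • z := (congrArg Subtype.val hc).symm
  rw [this]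
  exact M.smul_mem c hM

/-- If `α`, `β` and `α + β` are roots, then `[𝔤_α, 𝔤_β] = 𝔤_{α + β}`. -/
lemma rootSpace_add_le {α β γ : Weight ℂ H 𝔤} (hα : α.IsNonZero) (hγ0 : γ.IsNonZero)
    (hγ : (γ : H → ℂ) = α + β) {M : Submodule ℂ 𝔤}
    (hM : ∀ e ∈ rootSpace H α, ∀ x ∈ rootSpace H β, ⁅e, x⁆ ∈ M) :
    (rootSpace H γ).toSubmodule ≤ M := by
  obtain ⟨e, he, x, hx, hne⟩ := exists_lie_ne_zero hα hγ
  refine rootSpace_le_of_mem hγ0 ?_ hne (hM e he x hx)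
  rw [hγ]
  exact lie_mem_genWeightSpace_of_mem_genWeightSpace he hx

variable {b : (rootSystem H).Base} {i : b.support}

lemma rootSpace_le_gr {χ : H → ℂ} {j : ℤ} (hj : χ (gradingElement b i) = j) :
    (rootSpace H χ).toSubmodule ≤ gr b i j := by
  intro X hX
  rw [mem_gr, ← hj]
  exact lie_eq_smul_of_mem_rootSpace hX (gradingElement b i)

/-- `𝔤(j)` is the sum of the weight spaces on which `H_q` acts by `j`; the weight `0` is included,
its weight space `𝔥` lying in `𝔤(0)`. -/
lemma gr_eq_iSup (j : ℤ) : gr b i j =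
    ⨆ χ : {χ : Weight ℂ H 𝔤 // χ (gradingElement b i) = j}, (rootSpace H χ.1).toSubmodule := by
  set G : ℤ → Submodule ℂ 𝔤 := fun j =>
    ⨆ χ : {χ : Weight ℂ H 𝔤 // χ (gradingElement b i) = j}, (rootSpace H χ.1).toSubmodule with hG
  have hle : ∀ j, G j ≤ gr b i j := fun j => iSup_le fun χ => rootSpace_le_gr χ.2
  have htop : G j ⊔ ⨆ k ≠ j, gr b i k = ⊤ := by
    have h2 : (⊤ : Submodule ℂ 𝔤) =
        ⨆ χ : Weight ℂ H 𝔤, (genWeightSpace 𝔤 χ).toSubmodule := by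
      rw [← LieSubmodule.iSup_toSubmodule, iSup_genWeightSpace_eq_top' ℂ H 𝔤,
        LieSubmodule.top_toSubmodule]
    rw [eq_top_iff, h2]
    refine iSup_le fun χ => ?_
    obtain ⟨k, hk⟩ := exists_int_apply (b := b) (i := i) χ
    by_cases hkj : k = j
    · subst hkj
      exact le_sup_of_le_left (le_iSup (fun χ : {χ : Weight ℂ H 𝔤 //
        χ (gradingElement b i) = k} => (rootSpace H χ.1).toSubmodule) ⟨χ, hk⟩)
    · exact le_sup_of_le_right (le_iSup₂_of_le k hkj (rootSpace_le_gr hk))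
  refine le_antisymm ?_ (hle j)
  have hdisj := (iSupIndep_gr (b := b) (i := i)) j
  intro X hX
  obtain ⟨Y, hY, Z, hZ, rfl⟩ := Submodule.mem_sup.mp (htop ▸ Submodule.mem_top : X ∈ _)
  have hZ' : Z ∈ gr b i j := by
    have := sub_mem hX (hle j hY)
    rwa [add_sub_cancel_left] at this
  rw [Submodule.disjoint_def.mp hdisj Z hZ' hZ, add_zero]
  exact hY

open Classical in
lemma root_apply_gradingElement (k : b.support) :
    (k.1.1 : Weight ℂ H 𝔤) (gradingElement b i) = if k = i then 1 else 0 := by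
  have h1 : (k.1.1 : Weight ℂ H 𝔤) (gradingElement b i) =
      ((rootSystem H).root k) (gradingElement b i) := rfl
  rw [h1, apply_gradingElement, Module.Basis.coord_apply]
  have := b.toWeightBasis_repr_root k
  rw [this, Finsupp.single_apply]

/-- A root in which the distinguished simple root has positive multiplicity is positive. -/
lemma isPos_of_apply_gradingElement {β : H.root} {n : ℤ} (hn : 0 < n)
    (hβ : β.1 (gradingElement b i) = n) : b.IsPos β := by
  obtain ⟨f, hf, hpos, hsum⟩ := b.exists_root_eq_sum_int β
  have h1 : ((rootSystem H).root β) (gradingElement b i) = f i := by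
    rw [hsum, LinearMap.sum_apply, Finset.sum_eq_single (i : H.root)]
    · have := root_apply_gradingElement (b := b) (i := i) i
      rw [if_pos rfl] at this
      rw [LinearMap.smul_apply]
      change f i • (i.1.1 : Weight ℂ H 𝔤) (gradingElement b i) = _
      rw [this]
      simp
    · intro j hj hji
      have := root_apply_gradingElement (b := b) (i := i) ⟨j, hj⟩
      rw [if_neg (fun h => hji (congrArg Subtype.val h))] at this
      rw [LinearMap.smul_apply]
      change f j • (j.1 : Weight ℂ H 𝔤) (gradingElement b i) = _
      rw [this, smul_zero]
    · intro h; exact absurd i.2 h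
  have h2 : f i = n := by
    have : ((f i : ℤ) : ℂ) = n := h1.symm.trans hβ
    exact_mod_cast this
  have h3 : 0 < f := hpos.resolve_right fun h => by
    have : f i ≤ 0 := h.le i
    omega
  rw [RootPairing.Base.isPos_iff', RootPairing.Base.height_eq_sum hsum]
  exact Finset.sum_nonneg fun j _ => h3.le j

/-- The weight `c β`, for `c = ±1`; with it `𝔤(n)` and `𝔤(-n)` are treated together as `𝔤(c n)`. -/
def signWeight (c : ℤˣ) (β : Weight ℂ H 𝔤) : Weight ℂ H 𝔤 := if c = 1 then β else -β

lemma coe_signWeight (c : ℤˣ) (β : Weight ℂ H 𝔤) :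
    (signWeight c β : H → ℂ) = (c : ℤ) • (β : H → ℂ) := by
  rcases Int.units_eq_one_or c with rfl | rfl
  · simp [signWeight]
  · simp [signWeight]

lemma signWeight_isNonZero (c : ℤˣ) {β : Weight ℂ H 𝔤} (hβ : β.IsNonZero) :
    (signWeight c β).IsNonZero := by
  rcases Int.units_eq_one_or c with rfl | rfl
  · simpa [signWeight] using hβ
  · simpa [signWeight] using hβ.neg

/-- For `n > 0`, a subspace stable under `𝔩` contains `𝔤(± n)` as soon as it contains
`[𝔤_{± α_q}, 𝔤(± (n - 1))]`, and also `𝔤_{± α_q}` if `n = 1`. The proof is by induction over the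
positive roots, adding one simple root at a time: the simple roots other than `α_q` lie in `𝔩`. -/
lemma gr_le_of_generators (c : ℤˣ) {n : ℤ} (hn : 0 < n) {M : Submodule ℂ 𝔤}
    (hl : ∀ X ∈ gr b i 0, ∀ Y ∈ M, ⁅X, Y⁆ ∈ M)
    (h0 : n = 1 → (rootSpace H (signWeight c i.1.1)).toSubmodule ≤ M)
    (h1 : ∀ X ∈ rootSpace H (signWeight c i.1.1), ∀ Y ∈ gr b i (c * (n - 1)), ⁅X, Y⁆ ∈ M) :
    gr b i (c * n) ≤ M := by
  have hroot : ∀ β : H.root, β.1.IsNonZero := fun β => LieSubalgebra.isNonZero_coe_root β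
  have hlev : ∀ (β : Weight ℂ H 𝔤) (k : ℤ), β (gradingElement b i) = k →
      (signWeight c β) (gradingElement b i) = ((c * k : ℤ) : ℂ) := by
    intro β k hk
    rw [coe_signWeight, Pi.smul_apply, hk]
    simp
  have key : ∀ β : H.root, b.IsPos β → β.1 (gradingElement b i) = n →
      (rootSpace H (signWeight c β.1)).toSubmodule ≤ M := by
    intro β hβ
    refine hβ.induction_on_add (p := fun β => β.1 (gradingElement b i) = n →
      (rootSpace H (signWeight c β.1)).toSubmodule ≤ M) ?_ ?_
    · intro k hk hkn
      have h2 := root_apply_gradingElement (b := b) (i := i) ⟨k, hk⟩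
      rw [hkn] at h2
      split_ifs at h2 with hki
      · have : k = i.1 := congrArg Subtype.val hki
        subst this
        exact h0 (by exact_mod_cast h2)
      · have : n = 0 := by exact_mod_cast h2
        omega
    · intro β k γ hγ ih hk hγn
      have h2 := root_apply_gradingElement (b := b) (i := i) ⟨k, hk⟩
      have hγ' : (γ.1 : H → ℂ) = β.1 + k.1 := by
        funext h
        exact LinearMap.congr_fun hγ h
      have hγs : (signWeight c γ.1 : H → ℂ) = signWeight c k.1 + signWeight c β.1 := by
        simp only [coe_signWeight, hγ']
        module
      have h3 : γ.1 (gradingElement b i) = β.1 (gradingElement b i) + k.1 (gradingElement b i) := by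
        rw [hγ', Pi.add_apply]
      simp only at h2
      rw [hγn, h2] at h3
      refine rootSpace_add_le (signWeight_isNonZero c (hroot k)) (signWeight_isNonZero c (hroot γ))
        hγs fun e he x hx => ?_
      -- Adding `α_q` raises the degree by one, adding another simple root preserves it.
      split_ifs at h3 h2 with hki
      · have : k = i.1 := congrArg Subtype.val hki
        subst this
        refine h1 e he x (rootSpace_le_gr (hlev _ _ ?_) hx)
        push_cast
        linear_combination -h3
      · refine hl e ?_ x (ih (by rw [h3, add_zero]) hx)
        have := rootSpace_le_gr (hlev k.1 0 (by simpa using h2)) he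
        simpa using this
  rw [gr_eq_iSup]
  refine iSup_le fun χ => ?_
  have hχ : (signWeight c χ.1) (gradingElement b i) = n := by
    rw [hlev χ.1 _ χ.2, ← mul_assoc, Int.units_coe_mul_self, one_mul]
  have hne : (signWeight c χ.1).IsNonZero := by
    intro h
    rw [h.eq] at hχ
    simp only [Pi.zero_apply] at hχ
    have : n = 0 := by exact_mod_cast hχ.symm
    omega
  have hmem : signWeight c χ.1 ∈ H.root := by simpa using hne
  have h2 := key ⟨_, hmem⟩ (isPos_of_apply_gradingElement hn hχ) hχ
  have h3 : (signWeight c (signWeight c χ.1) : H → ℂ) = χ.1 := by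
    rw [coe_signWeight, coe_signWeight, smul_smul, Int.units_coe_mul_self, one_smul]
  simp only [h3] at h2
  exact h2

end Roots

/-! ### Irreducibility of `𝔤(-1)` and the quasi-Heisenberg condition -/

section Grading

lemma killingForm_lie_left {L : Type*} [LieRing L] [LieAlgebra ℂ L] (X Y Z : L) :
    killingForm ℂ L ⁅X, Y⁆ Z = -killingForm ℂ L Y ⁅X, Z⁆ := by
  rw [← lie_skew, map_neg, LinearMap.neg_apply, traceForm_apply_lie_apply]

variable {𝔤 : Type*} [LieRing 𝔤] [LieAlgebra ℂ 𝔤] [FiniteDimensional ℂ 𝔤]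
  [LieAlgebra.IsKilling ℂ 𝔤] {H : LieSubalgebra ℂ 𝔤} [H.IsCartanSubalgebra]
variable {b : (rootSystem H).Base} {i : b.support}

lemma cartan_le_gr_zero : H.toSubmodule ≤ gr b i 0 := by
  intro h hh
  rw [mem_gr]
  have : ⁅gradingElement b i, (⟨h, hh⟩ : H)⁆ = 0 := trivial_lie_zero _ _ _ _
  simpa using congrArg Subtype.val this

/-- As an `𝔩`-module, `𝔤(± 1)` is generated by the root space of `± α_q`. -/
lemma gr_sign_le (c : ℤˣ) {M : Submodule ℂ 𝔤}
    (hl : ∀ X ∈ gr b i 0, ∀ Y ∈ M, ⁅X, Y⁆ ∈ M)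
    (h0 : (rootSpace H (signWeight c i.1.1)).toSubmodule ≤ M) : gr b i c ≤ M := by
  have := gr_le_of_generators (b := b) (i := i) c one_pos hl (fun _ => h0) (fun X hX Y hY => by
    rw [sub_self, mul_zero] at hY
    rw [← lie_skew]
    exact neg_mem (hl Y hY X (h0 hX)))
  rwa [mul_one] at this

/-- `𝔤(-1)` is an irreducible `𝔩`-module, in terms of subspaces of `𝔤`. -/
lemma eq_bot_or_eq_gr_neg_one {U : Submodule ℂ 𝔤} (hU : U ≤ gr b i (-1))
    (hl : ∀ X ∈ gr b i 0, ∀ Y ∈ U, ⁅X, Y⁆ ∈ U) : U = ⊥ ∨ U = gr b i (-1) := by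
  by_cases hle : (rootSpace H (signWeight (-1) i.1.1)).toSubmodule ≤ U
  · right
    exact le_antisymm hU (by simpa using gr_sign_le (-1) hl hle)
  left
  -- Being `𝔥`-stable, `U` is the sum of its weight components, and all of them, by assumption none
  -- in `𝔤_{-α_q}`, are orthogonal to `𝔤_{α_q}`.
  let UH : LieSubmodule ℂ H 𝔤 :=
    { U with lie_mem := fun {h Y} hY => hl h (cartan_le_gr_zero h.2) Y hY }
  have hi0 : (i.1.1 : Weight ℂ H 𝔤).IsNonZero := LieSubalgebra.isNonZero_coe_root i.1
  have horth : ∀ e ∈ rootSpace H (i.1.1 : Weight ℂ H 𝔤), ∀ Z ∈ U, killingForm ℂ 𝔤 e Z = 0 := by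
    intro e he
    have h1 : UH ≤ ⨆ χ : Weight ℂ H 𝔤, UH ⊓ genWeightSpace 𝔤 χ :=
      (eq_iSup_inf_genWeightSpace (N := UH)).le
    have h2 : (⨆ χ : Weight ℂ H 𝔤, UH ⊓ genWeightSpace 𝔤 χ).toSubmodule ≤
        LinearMap.ker (killingForm ℂ 𝔤 e) := by
      rw [LieSubmodule.iSup_toSubmodule]
      refine iSup_le fun χ Z hZ => ?_
      obtain ⟨hZU, hZχ⟩ : Z ∈ U ∧ Z ∈ genWeightSpace 𝔤 χ := hZ
      rw [LinearMap.mem_ker]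
      by_cases hχ : (i.1.1 : H → ℂ) + χ = 0
      · by_contra hne
        have hχ' : χ = signWeight (-1) i.1.1 := by
          apply DFunLike.coe_injective
          rw [coe_signWeight, eq_neg_of_add_eq_zero_right hχ]
          simp
        subst hχ'
        refine hle (rootSpace_le_of_mem (signWeight_isNonZero _ hi0) hZχ ?_ hZU)
        rintro rfl
        exact hne (map_zero _)
      · exact killingForm_apply_eq_zero_of_mem_rootSpace_of_add_ne_zero ℂ 𝔤 H he hZχ hχ
    exact fun Z hZ => h2 (h1 hZ)
  -- The orthogonal complement of `U` is `𝔩`-stable, hence contains `𝔤(1)`.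
  let N : Submodule ℂ 𝔤 :=
    { carrier := {X | ∀ Z ∈ U, killingForm ℂ 𝔤 X Z = 0}
      add_mem' := fun {X Y} hX hY Z hZ => by
        rw [map_add, LinearMap.add_apply, hX Z hZ, hY Z hZ, add_zero]
      zero_mem' := fun Z _ => by simp
      smul_mem' := fun c X hX Z hZ => by
        rw [map_smul, LinearMap.smul_apply, hX Z hZ, smul_zero] }
  have hN : gr b i 1 ≤ N := by
    have := gr_sign_le (b := b) (i := i) 1 (M := N) (fun X hX Y hY Z hZ => by
      rw [killingForm_lie_left, hY _ (hl X hX Z hZ), neg_zero])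
      (fun e he Z hZ => horth e (by simpa [signWeight] using he) Z hZ)
    simpa using this
  rw [eq_bot_iff]
  intro Z hZ
  rw [Submodule.mem_bot]
  refine eq_zero_of_killingForm b i (hU hZ) fun Y hY => ?_
  rw [neg_neg] at hY
  rw [traceForm_comm]
  exact hN hY Z hZ

lemma gr_le_nilradical {j : ℤ} (hj : 0 < j) : gr b i j ≤ nilradical b i :=
  le_iSup (fun k : {j : ℤ // 0 < j} => gr b i k) ⟨j, hj⟩

/-- In the quasi-Heisenberg case `[𝔤(2), 𝔤(1)] = 0`, because `𝔤(2) = [𝔤(1), 𝔤(1)]`. -/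
lemma lie_gr_two_gr_one (hq : IsQuasiHeisenberg b i) {X Y : 𝔤} (hX : X ∈ gr b i 2)
    (hY : Y ∈ gr b i 1) : ⁅X, Y⁆ = 0 := by
  let M : Submodule ℂ 𝔤 := Submodule.span ℂ {W | ∃ A ∈ gr b i 1, ∃ B ∈ gr b i 1, W = ⁅A, B⁆}
  have hM : gr b i 2 ≤ M := by
    have := gr_le_of_generators (b := b) (i := i) 1 (n := 2) two_pos (M := M) ?_ (by simp) ?_
    · simpa using this
    · intro Z hZ W hW
      induction hW using Submodule.span_induction with
      | mem W hW =>
        obtain ⟨A, hA, B, hB, rfl⟩ := hW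
        rw [leibniz_lie]
        have h1 : ⁅Z, A⁆ ∈ gr b i 1 := by simpa using lie_mem_gr hZ hA
        have h2 : ⁅Z, B⁆ ∈ gr b i 1 := by simpa using lie_mem_gr hZ hB
        exact add_mem (Submodule.subset_span ⟨_, h1, _, hB, rfl⟩)
          (Submodule.subset_span ⟨_, hA, _, h2, rfl⟩)
      | zero => simp
      | add U V _ _ hU hV => rw [lie_add]; exact add_mem hU hV
      | smul c U _ hU => rw [lie_smul]; exact M.smul_mem c hU
    · intro e he B hB
      refine Submodule.subset_span ⟨e, ?_, B, by simpa using hB, rfl⟩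
      refine rootSpace_le_gr ?_ he
      have := root_apply_gradingElement (b := b) (i := i) i
      simpa [signWeight] using this
  have hker : M ≤ LinearMap.ker (ad ℂ 𝔤 Y) := by
    rw [Submodule.span_le]
    rintro W ⟨A, hA, B, hB, rfl⟩
    exact hq.two_step Y (gr_le_nilradical one_pos hY) A (gr_le_nilradical one_pos hA)
      B (gr_le_nilradical one_pos hB)
  have h := hker (hM hX)
  rw [LinearMap.mem_ker, ad_apply] at h
  rw [← lie_skew, h, neg_zero]

/-- If `𝔤(2)` were zero, so would be every `𝔤(j)` with `j ≥ 2`, since `𝔤(j)` is generated by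
`[𝔤_{α_q}, 𝔤(j - 1)]`; then `𝔫 = 𝔤(1)` would be abelian. -/
lemma gr_two_ne_bot (hq : IsQuasiHeisenberg b i) : gr b i 2 ≠ ⊥ := by
  intro h2
  have hn : ∀ n : ℕ, gr b i (n + 2) = ⊥ := by
    intro n
    induction n with
    | zero => simpa using h2
    | succ n ih =>
      rw [eq_bot_iff]
      have := gr_le_of_generators (b := b) (i := i) 1 (n := n + 3) (by omega) (M := ⊥)
        (by simp) (by intro h; omega) (fun X _ Y hY => by
          rw [Units.val_one, one_mul, show (n + 3 - 1 : ℤ) = n + 2 by ring, ih] at hY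
          rw [(Submodule.mem_bot ℂ).mp hY]
          simp)
      rw [Units.val_one, one_mul] at this
      convert this using 2
      push_cast
      ring
  have hle : nilradical b i ≤ gr b i 1 := by
    refine iSup_le fun j => ?_
    obtain ⟨j, hj⟩ := j
    rcases eq_or_ne j 1 with rfl | hj1
    · exact le_rfl
    · have := hn (j - 2).toNat
      rw [show (((j - 2).toNat : ℤ) + 2) = j by omega] at this
      simp [this]
  have h1 := hq.one_lt_dim
  have h3 : Submodule.span ℂ
    {W : 𝔤 | ∃ X ∈ nilradical b i, ∃ Y ∈ nilradical b i, W = ⁅X, Y⁆} = ⊥ := by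
    rw [eq_bot_iff, Submodule.span_le]
    rintro W ⟨X, hX, Y, hY, rfl⟩
    have := lie_mem_gr (hle hX) (hle hY)
    rwa [one_add_one_eq_two, h2] at this
  rw [h3, finrank_bot] at h1
  omega

/-- Nonzero root vectors for the negatives of the roots of `𝔤(1)` form a basis of `𝔤(-1)`. -/
def rootVectorBasis {m : ℕ} (α : Fin m ≃ DeltaOne b i) (x : Fin m → grMod b i (-1))
    (hx : ∀ j, (x j : 𝔤) ∈ rootSpace H (-((α j).1 : H → ℂ))) (hx0 : ∀ j, x j ≠ 0) :
    Module.Basis (Fin m) ℂ (grMod b i (-1)) := by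
  refine Module.Basis.mk (v := x) ?_ ?_
  · have h1 : iSupIndep fun χ : Weight ℂ H 𝔤 => (genWeightSpace 𝔤 χ).toSubmodule :=
      LieSubmodule.iSupIndep_toSubmodule.mpr (iSupIndep_genWeightSpace' ℂ H 𝔤)
    have hinj : Function.Injective fun j => (-(α j).1 : Weight ℂ H 𝔤) := by
      intro j k hjk
      exact α.injective (Subtype.ext (neg_injective hjk))
    have h2 := (h1.comp hinj).linearIndependent (v := fun j => (x j : 𝔤)) _
      (fun j => by simpa using hx j) (fun j h => hx0 j (Subtype.ext h))
    exact LinearIndependent.of_comp (grMod b i (-1)).toSubmodule.subtype h2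
  · have h1 : gr b i (-1) ≤ (Submodule.span ℂ (Set.range x)).map
        (grMod b i (-1)).toSubmodule.subtype := by
      rw [gr_eq_iSup]
      refine iSup_le fun χ => ?_
      have hχ := χ.2
      have hne : (-χ.1).IsNonZero := by
        intro h
        have h2 : χ.1.IsZero := by simpa using h
        rw [h2.eq] at hχ
        simp at hχ
      have hgr : (rootSpace H (-χ.1 : Weight ℂ H 𝔤)).toSubmodule ≤ gr b i 1 :=
        rootSpace_le_gr (by simp [hχ])
      obtain ⟨j, hj⟩ := α.surjective ⟨-χ.1, hne, hgr⟩
      have h3 : (x j : 𝔤) ∈ rootSpace H χ.1 := by simpa [hj] using hx j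
      refine rootSpace_le_of_mem (by simpa using hne.neg) h3 (fun h => hx0 j (Subtype.ext h))
        ⟨x j, Submodule.subset_span ⟨j, rfl⟩, rfl⟩
    intro X _
    obtain ⟨Y, hY, hYX⟩ := h1 X.2
    rwa [← Subtype.ext hYX]

end Grading

/-! ### The map `τ₁` and the irreducible constituents of `W^*` -/

section Contraction

lemma isIrreducible_of_surjective {L M N : Type*} [LieRing L] [LieAlgebra ℂ L]
    [AddCommGroup M] [Module ℂ M] [LieRingModule L M]
    [AddCommGroup N] [Module ℂ N] [LieRingModule L N]
    [LieModule.IsIrreducible ℂ L M] [Nontrivial N]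
    (f : M →ₗ⁅ℂ,L⁆ N) (hf : Function.Surjective f) : LieModule.IsIrreducible ℂ L N := by
  refine LieModule.IsIrreducible.mk fun P hP => ?_
  have h1 : P.comap f ≠ ⊥ := by
    intro h
    refine hP ((LieSubmodule.eq_bot_iff _).mpr fun y hy => ?_)
    obtain ⟨x, rfl⟩ := hf y
    have hx : x ∈ P.comap f := hy
    rw [h, LieSubmodule.mem_bot] at hx
    rw [hx, map_zero]
  have h2 := (eq_bot_or_eq_top (P.comap f)).resolve_left h1
  rw [eq_top_iff]
  intro y _
  obtain ⟨x, rfl⟩ := hf y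
  have : x ∈ P.comap f := h2 ▸ LieSubmodule.mem_top x
  exact this

/-- Schur's lemma: a nonzero homomorphism of irreducible modules is bijective. -/
lemma bijective_of_isIrreducible {L M N : Type*} [LieRing L] [LieAlgebra ℂ L]
    [AddCommGroup M] [Module ℂ M] [LieRingModule L M] [LieModule ℂ L M]
    [AddCommGroup N] [Module ℂ N] [LieRingModule L N] [LieModule ℂ L N]
    [LieModule.IsIrreducible ℂ L M] [LieModule.IsIrreducible ℂ L N]
    (f : M →ₗ⁅ℂ,L⁆ N) {x : M} (hx : f x ≠ 0) : Function.Bijective f := by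
  constructor
  · rw [← LieModuleHom.ker_eq_bot]
    refine (eq_bot_or_eq_top f.ker).resolve_right fun h => hx ?_
    exact LieModuleHom.mem_ker.mp (h ▸ LieSubmodule.mem_top x)
  · rw [← LieModuleHom.range_eq_top]
    refine (eq_bot_or_eq_top f.range).resolve_left fun h => hx ?_
    have h1 : f x ∈ f.range := (LieModuleHom.mem_range f _).mpr ⟨x, rfl⟩
    rwa [h, LieSubmodule.mem_bot] at h1

variable {𝔤 : Type*} [LieRing 𝔤] [LieAlgebra ℂ 𝔤] [FiniteDimensional ℂ 𝔤]
  [LieAlgebra.IsKilling ℂ 𝔤] {H : LieSubalgebra ℂ 𝔤} [H.IsCartanSubalgebra]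
variable {b : (rootSystem H).Base} {i : b.support}

/-- The module form of `eq_bot_or_eq_gr_neg_one`. -/
instance isIrreducible_grMod_neg_one : LieModule.IsIrreducible ℂ (levi b i) (grMod b i (-1)) := by
  have hi0 : (i.1.1 : Weight ℂ H 𝔤).IsNonZero := LieSubalgebra.isNonZero_coe_root i.1
  have : Nontrivial (grMod b i (-1)) := by
    obtain ⟨z, hz, hz0⟩ := (-(i.1.1 : Weight ℂ H 𝔤)).exists_ne_zero
    have hmem : z ∈ gr b i (-1) := by
      refine rootSpace_le_gr ?_ hz
      have := root_apply_gradingElement (b := b) (i := i) i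
      simpa using this
    exact ⟨⟨z, hmem⟩, 0, fun h => hz0 (congrArg Subtype.val h)⟩
  refine LieModule.IsIrreducible.mk fun N hN => ?_
  let U : Submodule ℂ 𝔤 := N.toSubmodule.map (grMod b i (-1)).toSubmodule.subtype
  have hU : U ≤ gr b i (-1) := by
    rintro _ ⟨X, _, rfl⟩
    exact X.2
  have hl : ∀ X ∈ gr b i 0, ∀ Y ∈ U, ⁅X, Y⁆ ∈ U := by
    rintro X hX _ ⟨Y, hY, rfl⟩
    have h := N.lie_mem (x := (⟨X, hX⟩ : levi b i)) hY
    exact ⟨_, h, rfl⟩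
  rcases eq_bot_or_eq_gr_neg_one hU hl with h | h
  · refine absurd ((LieSubmodule.eq_bot_iff _).mpr fun X hX => ?_) hN
    have h1 : (X : 𝔤) ∈ U := ⟨X, hX, rfl⟩
    rw [h, Submodule.mem_bot] at h1
    exact Subtype.ext h1
  · rw [eq_top_iff]
    intro X _
    have h1 : (X : 𝔤) ∈ U := h ▸ X.2
    obtain ⟨Y, hY, hYX⟩ := h1
    have : Y = X := Subtype.ext hYX
    exact this ▸ hY

variable (b i) in
/-- The bracket `𝔤(j) ⊗ 𝔤(k) → 𝔤(l)` for `j + k = l`. -/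
def gradedBracket (j k l : ℤ) (h : j + k = l) :
    grMod b i j ⊗[ℂ] grMod b i k →ₗ[ℂ] grMod b i l :=
  TensorProduct.lift (LinearMap.mk₂ ℂ
    (fun X Z => ⟨⁅(X : 𝔤), (Z : 𝔤)⁆, h ▸ lie_mem_gr X.2 Z.2⟩)
    (fun X X' Z => Subtype.ext (add_lie (X : 𝔤) (X' : 𝔤) (Z : 𝔤)))
    (fun c X Z => Subtype.ext (smul_lie c (X : 𝔤) (Z : 𝔤)))
    (fun X Z Z' => Subtype.ext (lie_add (X : 𝔤) (Z : 𝔤) (Z' : 𝔤)))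
    (fun c X Z => Subtype.ext (lie_smul c (X : 𝔤) (Z : 𝔤))))

lemma gradedBracket_lie {j k l : ℤ} (h : j + k = l) (A : levi b i)
    (t : grMod b i j ⊗[ℂ] grMod b i k) :
    gradedBracket b i j k l h ⁅A, t⁆ = ⁅A, gradedBracket b i j k l h t⁆ := by
  induction t using TensorProduct.induction_on with
  | zero => simp
  | add t u ht hu => simp only [lie_add, map_add, ht, hu]
  | tmul X Y =>
    rw [TensorProduct.LieModule.lie_tmul_right, map_add]
    refine Subtype.ext ?_
    change ⁅⁅(A : 𝔤), (X : 𝔤)⁆, (Y : 𝔤)⁆ + ⁅(X : 𝔤), ⁅(A : 𝔤), (Y : 𝔤)⁆⁆ =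
      ⁅(A : 𝔤), ⁅(X : 𝔤), (Y : 𝔤)⁆⁆
    rw [leibniz_lie (A : 𝔤)]

lemma killingForm_killingEquiv_symm {j : ℤ} (f : Module.Dual ℂ (grMod b i j))
    (Y : grMod b i j) : killingForm ℂ 𝔤 ((killingEquiv b i j).symm f : 𝔤) Y = f Y := by
  have h := LinearMap.congr_fun ((killingEquiv b i j).apply_symm_apply f) Y
  exact h

lemma grMod_ext {j : ℤ} {X X' : grMod b i (-j)}
    (h : ∀ Y : grMod b i j, killingForm ℂ 𝔤 (X : 𝔤) Y = killingForm ℂ 𝔤 (X' : 𝔤) Y) : X = X' :=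
  (killingEquiv b i j).injective (LinearMap.ext h)

/-- `ω` corresponds to the identity of `𝔤(2)`, and is therefore `𝔩`-invariant. -/
lemma lie_omega (A : levi b i) : ⁅A, omega b i⁆ = 0 := by
  set B := Module.finBasis ℂ (grMod b i 2) with hB
  have h1 : ∀ k, ⁅A, B k⁆ = ∑ j, B.coord j ⁅A, B k⁆ • B j := fun k => (B.sum_repr _).symm
  have h2 : ∀ k, ⁅A, (killingEquiv b i 2).symm (B.coord k)⁆ =
      -∑ j, B.coord k ⁅A, B j⁆ • (killingEquiv b i 2).symm (B.coord j) := by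
    intro k
    simp only [← map_smul, ← map_sum, ← map_neg]
    refine grMod_ext fun Y => ?_
    rw [killingForm_killingEquiv_symm]
    change killingForm ℂ 𝔤 ⁅(A : 𝔤), ((killingEquiv b i 2).symm (B.coord k) : 𝔤)⁆ Y = _
    rw [killingForm_lie_left]
    change -killingForm ℂ 𝔤 ((killingEquiv b i 2).symm (B.coord k) : 𝔤) (⁅A, Y⁆ : grMod b i 2) = _
    rw [killingForm_killingEquiv_symm]
    conv_lhs => rw [← B.sum_repr Y]
    rw [lie_sum, map_sum, LinearMap.neg_apply, LinearMap.sum_apply]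
    congr 1
    refine Finset.sum_congr rfl fun j _ => ?_
    rw [lie_smul, map_smul, LinearMap.smul_apply, smul_eq_mul, smul_eq_mul, mul_comm]
    rfl
  -- The matrix of `A` on the dual basis of `𝔤(-2)` is minus the transpose of its matrix on `𝔤(2)`,
  -- so the two halves of the Leibniz rule cancel after exchanging the summations.
  rw [omega, ← hB, lie_sum]
  simp only [TensorProduct.LieModule.lie_tmul_right, Finset.sum_add_distrib]
  simp only [h2]
  conv_lhs => enter [2, 2, k]; rw [h1 k]
  simp only [TensorProduct.neg_tmul, TensorProduct.sum_tmul, TensorProduct.tmul_sum,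
    TensorProduct.smul_tmul', TensorProduct.tmul_smul, Finset.sum_neg_distrib]
  rw [Finset.sum_comm, neg_add_cancel]

variable (b i) in
/-- `S = ∑_γ [X_γ^*, X_γ]`, an element of `𝔤(0)`. -/
def casimirBracket : grMod b i 0 := gradedBracket b i (-2) 2 0 (by norm_num) (omega b i)

lemma lie_casimirBracket (A : levi b i) : ⁅(A : 𝔤), (casimirBracket b i : 𝔤)⁆ = 0 := by
  have h : ⁅A, casimirBracket b i⁆ = 0 := by
    rw [casimirBracket, ← gradedBracket_lie, lie_omega, map_zero]
  exact congrArg Subtype.val h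

lemma killingForm_casimirBracket :
    killingForm ℂ 𝔤 (gradingElement b i : 𝔤) (casimirBracket b i) =
      -2 * Module.finrank ℂ (grMod b i 2) := by
  have h0 : (casimirBracket b i : 𝔤) = ∑ k, ⁅((killingEquiv b i 2).symm
      ((Module.finBasis ℂ (grMod b i 2)).coord k) : 𝔤), (Module.finBasis ℂ (grMod b i 2) k : 𝔤)⁆ := by
    rw [casimirBracket, omega, map_sum]
    exact map_sum (grMod b i 0).toSubmodule.subtype _ _
  rw [h0, map_sum]
  have h1 : ∀ k, killingForm ℂ 𝔤 (gradingElement b i : 𝔤) ⁅((killingEquiv b i 2).symm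
      ((Module.finBasis ℂ (grMod b i 2)).coord k) : 𝔤),
      (Module.finBasis ℂ (grMod b i 2) k : 𝔤)⁆ = -2 := by
    intro k
    rw [← traceForm_apply_lie_apply, mem_gr.mp ((killingEquiv b i 2).symm
      ((Module.finBasis ℂ (grMod b i 2)).coord k)).2, map_smul, LinearMap.smul_apply]
    have := killingForm_killingEquiv_symm ((Module.finBasis ℂ (grMod b i 2)).coord k)
      (Module.finBasis ℂ (grMod b i 2) k)
    erw [this]
    simp
  simp only [h1]
  simp [mul_comm]

/-- The element `S` is central in `𝔩`, hence a multiple of `H_q`; its Killing product with `H_q`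
is `-2 dim 𝔤(2)`. -/
lemma exists_casimirBracket_eq_smul (h2 : gr b i 2 ≠ ⊥) :
    ∃ c : ℂ, c ≠ 0 ∧ (casimirBracket b i : 𝔤) = c • (gradingElement b i : 𝔤) := by
  -- `S` commutes with `𝔥 ⊆ 𝔩`, and `𝔥` is its own centralizer.
  have hS : (casimirBracket b i : 𝔤) ∈ H := by
    have : (casimirBracket b i : 𝔤) ∈ rootSpace H (0 : H → ℂ) := by
      refine (mem_genWeightSpace _ _ _).mpr fun x => ⟨1, ?_⟩
      simpa using lie_casimirBracket (⟨x, cartan_le_gr_zero x.2⟩ : levi b i)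
    rwa [rootSpace_zero_eq] at this
  set S : H := ⟨casimirBracket b i, hS⟩ with hSdef
  -- Every simple root other than `α_q` vanishes on `S`, because its root space lies in `𝔩`.
  have hcoord : S = (i.1.1 : Weight ℂ H 𝔤) S • gradingElement b i := by
    have hall : ∀ f : Module.Dual ℂ H, f S = f ((i.1.1 : Weight ℂ H 𝔤) S • gradingElement b i) := by
      intro f
      have : Module.Dual.eval ℂ H S =
          Module.Dual.eval ℂ H ((i.1.1 : Weight ℂ H 𝔤) S • gradingElement b i) := by
        refine b.toWeightBasis.ext fun k => ?_
        rw [b.toWeightBasis_apply, Module.Dual.eval_apply, Module.Dual.eval_apply, map_smul]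
        change (k.1.1 : Weight ℂ H 𝔤) S = _ • (k.1.1 : Weight ℂ H 𝔤) (gradingElement b i)
        classical
        have hk := root_apply_gradingElement (b := b) (i := i) k
        split_ifs at hk with hki
        · rw [hk, hki]; simp
        · rw [hk, smul_zero]
          obtain ⟨e, he, he0⟩ := (k.1.1 : Weight ℂ H 𝔤).exists_ne_zero
          have he' : e ∈ gr b i 0 := rootSpace_le_gr (by simpa using hk) he
          have h1 := lie_casimirBracket (⟨e, he'⟩ : levi b i)
          have h3 := lie_eq_smul_of_mem_rootSpace he S
          have h4 : ⁅S, e⁆ = 0 := by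
            change ⁅(casimirBracket b i : 𝔤), e⁆ = 0
            rw [← lie_skew, neg_eq_zero]
            exact h1
          rw [h4] at h3
          exact (smul_eq_zero.mp h3.symm).resolve_right he0
      exact LinearMap.congr_fun this f
    rw [← sub_eq_zero, ← Module.forall_dual_apply_eq_zero_iff ℂ]
    intro f
    rw [map_sub, hall f, sub_self]
  refine ⟨(i.1.1 : Weight ℂ H 𝔤) S, ?_, ?_⟩
  · intro h0
    rw [h0, zero_smul] at hcoord
    have h1 := killingForm_casimirBracket (b := b) (i := i)
    have h3 : (casimirBracket b i : 𝔤) = 0 := congrArg Subtype.val hcoord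
    rw [h3, map_zero] at h1
    have h4 : Module.finrank ℂ (grMod b i 2) ≠ 0 := by
      intro h
      exact h2 (Submodule.finrank_eq_zero.mp h)
    have : (Module.finrank ℂ (grMod b i 2) : ℂ) ≠ 0 := by exact_mod_cast h4
    simp [this] at h1
  · exact congrArg Subtype.val hcoord

/-- `τ₁` is `𝔩`-equivariant. -/
lemma lie_tauOne (A : levi b i) (X : grMod b i 1) : tauOne b i ⁅A, X⁆ = ⁅A, tauOne b i X⁆ := by
  have key : ∀ t : grMod b i (-2) ⊗[ℂ] grMod b i 2,
      ⁅A, (adOne b i X).rTensor (grMod b i 2) t⁆ =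
        (adOne b i ⁅A, X⁆).rTensor (grMod b i 2) t +
        (adOne b i X).rTensor (grMod b i 2) ⁅A, t⁆ := by
    intro t
    induction t using TensorProduct.induction_on with
    | zero => simp
    | add t u ht hu => simp only [lie_add, map_add, ht, hu]; abel
    | tmul Z Y =>
      simp only [LinearMap.rTensor_tmul, TensorProduct.LieModule.lie_tmul_right, map_add]
      rw [← add_assoc, ← TensorProduct.add_tmul]
      congr 2
      refine Subtype.ext ?_
      change ⁅(A : 𝔤), ⁅(X : 𝔤), (Z : 𝔤)⁆⁆ = ⁅⁅(A : 𝔤), (X : 𝔤)⁆, (Z : 𝔤)⁆ +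
        ⁅(X : 𝔤), ⁅(A : 𝔤), (Z : 𝔤)⁆⁆
      rw [leibniz_lie (A : 𝔤)]
  have h := key (omega b i)
  rw [lie_omega, map_zero, add_zero] at h
  exact h.symm

variable (b i) in
/-- The `𝔩`-homomorphism `W^* → 𝔤(-1)` obtained from `τ̃₁` by the duality of `𝔤(1)` and `𝔤(-1)`, so
that `Ω₁(Y^*)` is the right differentiation along the image of `Y^*`. -/
def omegaHom : Module.Dual ℂ (W b i) →ₗ⁅ℂ, levi b i⁆ grMod b i (-1) where
  toFun Y := (killingEquiv b i 1).symm (tauTildeOne b i Y)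
  map_add' Y Y' := by rw [← map_add]; rfl
  map_smul' c Y := by rw [RingHom.id_apply, ← map_smul]; rfl
  map_lie' := by
    intro A Y
    refine grMod_ext fun X => ?_
    change killingForm ℂ 𝔤 ((killingEquiv b i 1).symm (tauTildeOne b i ⁅A, Y⁆) : 𝔤) X =
      killingForm ℂ 𝔤 ⁅(A : 𝔤), ((killingEquiv b i 1).symm (tauTildeOne b i Y) : 𝔤)⁆ X
    rw [killingForm_lie_left, killingForm_killingEquiv_symm]
    change _ = -killingForm ℂ 𝔤 ((killingEquiv b i 1).symm (tauTildeOne b i Y) : 𝔤)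
      (⁅A, X⁆ : grMod b i 1)
    rw [killingForm_killingEquiv_symm]
    change (⁅A, Y⁆ : Module.Dual ℂ (W b i)) (tauOne b i X) = -Y (tauOne b i ⁅A, X⁆)
    rw [lie_tauOne]
    rfl

variable (b i) in
/-- The transpose `𝔤(-1) ≅ 𝔤(1)^* → W^*` of the bracket `W = 𝔤(-1) ⊗ 𝔤(2) → 𝔤(1)`. -/
def bracketTranspose : grMod b i (-1) →ₗ⁅ℂ, levi b i⁆ Module.Dual ℂ (W b i) where
  toFun Z := killingEquiv b i 1 Z ∘ₗ gradedBracket b i (-1) 2 1 (by norm_num)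
  map_add' Z Z' := by rw [map_add, LinearMap.add_comp]
  map_smul' c Z := by rw [map_smul, LinearMap.smul_comp]; rfl
  map_lie' := by
    intro A Z
    refine LinearMap.ext fun t => ?_
    change _ = -killingEquiv b i 1 Z (gradedBracket b i (-1) 2 1 (by norm_num) ⁅A, t⁆)
    rw [gradedBracket_lie]
    exact killingForm_lie_left (A : 𝔤) (Z : 𝔤) _

/-- Contracting `τ₁(X)` by the bracket gives `[X, S]`, because `[𝔤(1), 𝔤(2)] = 0`. -/
lemma gradedBracket_tauOne (hq : IsQuasiHeisenberg b i) (X : grMod b i 1) :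
    (gradedBracket b i (-1) 2 1 (by norm_num) (tauOne b i X) : 𝔤) =
      ⁅(X : 𝔤), (casimirBracket b i : 𝔤)⁆ := by
  have key : ∀ t : grMod b i (-2) ⊗[ℂ] grMod b i 2,
      (gradedBracket b i (-1) 2 1 (by norm_num) ((adOne b i X).rTensor (grMod b i 2) t) : 𝔤) =
        ⁅(X : 𝔤), (gradedBracket b i (-2) 2 0 (by norm_num) t : 𝔤)⁆ := by
    intro t
    induction t using TensorProduct.induction_on with
    | zero => simp
    | add t u ht hu => simp only [map_add, LieSubmodule.coe_add, ht, hu, lie_add]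
    | tmul Z Y =>
      change ⁅⁅(X : 𝔤), (Z : 𝔤)⁆, (Y : 𝔤)⁆ = ⁅(X : 𝔤), ⁅(Z : 𝔤), (Y : 𝔤)⁆⁆
      rw [leibniz_lie (X : 𝔤), ← lie_skew (X : 𝔤) (Y : 𝔤), lie_gr_two_gr_one hq Y.2 X.2]
      simp
  exact key _

/-- The composition `𝔤(-1) → W^* → 𝔤(-1)` is dual to `X ↦ [X, S]` on `𝔤(1)`, a nonzero multiple of
the identity. -/
lemma exists_omegaHom_bracketTranspose (hq : IsQuasiHeisenberg b i) :
    ∃ c : ℂ, c ≠ 0 ∧ ∀ Z, omegaHom b i (bracketTranspose b i Z) = c • Z := by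
  obtain ⟨c, hc, hS⟩ := exists_casimirBracket_eq_smul (gr_two_ne_bot hq)
  refine ⟨-c, neg_ne_zero.mpr hc, fun Z => grMod_ext fun X => ?_⟩
  change killingForm ℂ 𝔤 ((killingEquiv b i 1).symm (tauTildeOne b i (bracketTranspose b i Z)) : 𝔤)
    X = killingForm ℂ 𝔤 (-c • (Z : 𝔤)) X
  rw [killingForm_killingEquiv_symm]
  change killingForm ℂ 𝔤 (Z : 𝔤) (gradedBracket b i (-1) 2 1 (by norm_num) (tauOne b i X) : 𝔤) = _
  rw [gradedBracket_tauOne hq, hS, lie_smul, ← lie_skew, mem_gr.mp X.2]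
  simp

/-- The `Ω₁` constituent of `W^*`: there is an irreducible submodule on which `τ̃₁` does not
vanish. -/
lemma exists_isIrreducible_tauTildeOne_ne_zero (hq : IsQuasiHeisenberg b i) :
    ∃ V : LieSubmodule ℂ (levi b i) (Module.Dual ℂ (W b i)),
      LieModule.IsIrreducible ℂ (levi b i) V ∧ ∃ Y ∈ V, tauTildeOne b i Y ≠ 0 := by
  obtain ⟨c, hc, hcZ⟩ := exists_omegaHom_bracketTranspose hq
  obtain ⟨Z, hZ⟩ := @exists_ne _ (LieModule.nontrivial_of_isIrreducible ℂ (levi b i)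
    (grMod b i (-1))) 0
  let f : grMod b i (-1) →ₗ⁅ℂ, levi b i⁆ (bracketTranspose b i).range :=
    { toFun := fun Z => ⟨bracketTranspose b i Z, (LieModuleHom.mem_range _ _).mpr ⟨Z, rfl⟩⟩
      map_add' := fun Z Z' => Subtype.ext (map_add (bracketTranspose b i) Z Z')
      map_smul' := fun c Z => Subtype.ext (map_smul (bracketTranspose b i) c Z)
      map_lie' := fun {A Z} => Subtype.ext (LieModuleHom.map_lie (bracketTranspose b i) A Z) }
  have hne : bracketTranspose b i Z ≠ 0 := by
    intro h
    have := hcZ Z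
    rw [h, map_zero, eq_comm, smul_eq_zero] at this
    exact this.elim hc hZ
  have hmem : bracketTranspose b i Z ∈ (bracketTranspose b i).range :=
    (LieModuleHom.mem_range _ _).mpr ⟨Z, rfl⟩
  have : Nontrivial (bracketTranspose b i).range :=
    ⟨⟨_, hmem⟩, 0, fun h => hne (congrArg Subtype.val h)⟩
  refine ⟨(bracketTranspose b i).range, isIrreducible_of_surjective f ?_, _, hmem, ?_⟩
  · rintro ⟨Y, hY⟩
    obtain ⟨Z, rfl⟩ := (LieModuleHom.mem_range _ _).mp hY
    exact ⟨Z, rfl⟩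
  · intro h
    have h1 := hcZ Z
    have h2 : omegaHom b i (bracketTranspose b i Z) = 0 := by
      change (killingEquiv b i 1).symm (tauTildeOne b i _) = 0
      rw [h, map_zero]
    rw [h2, eq_comm, smul_eq_zero] at h1
    exact h1.elim hc hZ

/-- By Schur's lemma, `omegaHom` maps every `Ω₁` constituent of `W^*` isomorphically to
`𝔤(-1)`. -/
def omegaEquiv (V : LieSubmodule ℂ (levi b i) (Module.Dual ℂ (W b i)))
    (hV : LieModule.IsIrreducible ℂ (levi b i) V) (h : ∃ Y ∈ V, tauTildeOne b i Y ≠ 0) :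
    V ≃ₗ[ℂ] grMod b i (-1) :=
  LinearEquiv.ofBijective ((omegaHom b i).comp V.incl : V →ₗ[ℂ] grMod b i (-1)) <| by
    obtain ⟨Y, hY, hne⟩ := h
    refine bijective_of_isIrreducible ((omegaHom b i).comp V.incl) (x := ⟨Y, hY⟩) ?_
    change (killingEquiv b i 1).symm (tauTildeOne b i Y) ≠ 0
    simpa using hne

end Contraction

/-! ### Real coordinates on `End 𝔤` -/

section Coordinates

variable {𝔤 : Type*} [LieRing 𝔤] [LieAlgebra ℂ 𝔤] [FiniteDimensional ℂ 𝔤]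

variable (𝔤) in
/-- Real coordinates on `End 𝔤`. -/
def endCoord : Module.End ℂ 𝔤 ≃ₗ[ℝ] (Fin (Module.finrank ℝ (Module.End ℂ 𝔤)) → ℝ) :=
  (Module.finBasis ℝ (Module.End ℂ 𝔤)).equivFun

/-- Right multiplication by `ad X` in the coordinates `endCoord`. -/
def rightField (X : 𝔤) : (Fin (Module.finrank ℝ (Module.End ℂ 𝔤)) → ℝ) →L[ℝ]
    (Fin (Module.finrank ℝ (Module.End ℂ 𝔤)) → ℝ) :=
  LinearMap.toContinuousLinearMap ((endCoord 𝔤).toLinearMap ∘ₗ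
    (LinearMap.mulRight ℂ (ad ℂ 𝔤 X)).restrictScalars ℝ ∘ₗ (endCoord 𝔤).symm.toLinearMap)

lemma rightField_endCoord (X : 𝔤) (v : Module.End ℂ 𝔤) :
    rightField X (endCoord 𝔤 v) = endCoord 𝔤 (v * ad ℂ 𝔤 X) := by
  simp [rightField]

end Coordinates

/-! ### The algebra of right differentiations -/

section RightDifferentiation

variable {𝔤 : Type*} [LieRing 𝔤] [LieAlgebra ℂ 𝔤] [FiniteDimensional ℂ 𝔤]
  [LieAlgebra.IsKilling ℂ 𝔤] {H : LieSubalgebra ℂ 𝔤} [H.IsCartanSubalgebra]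
variable {b : (rootSystem H).Base} {i : b.support} (σ : RealForm b i)

lemma toEnd_mul_expN (n : OppGroup σ) (X : realNilradicalOpp σ) (t : ℝ) :
    toEnd σ (n * expN σ (t • X)) = toEnd σ n * nilExp (t • ad ℂ 𝔤 (X : 𝔤)) := by
  have h2 : ad ℂ 𝔤 ((t • X : realNilradicalOpp σ) : 𝔤) = t • ad ℂ 𝔤 (X : 𝔤) := by
    ext Y
    change ⁅(t : ℂ) • (X : 𝔤), Y⁆ = (t : ℂ) • ⁅(X : 𝔤), Y⁆
    rw [smul_lie]
  rw [← h2]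
  rfl

/-- `d/dt ℓ(n̄ exp(tX)) = ℓ(n̄ ad X)` at `t = 0`, for a linear form `ℓ` on `End 𝔤`; the curve is
polynomial in `t` because `ad X` is nilpotent. -/
lemma hasDerivAt_toEnd {F : Type*} [NormedAddCommGroup F] [NormedSpace ℝ F]
    (ℓ : Module.End ℂ 𝔤 →ₗ[ℝ] F) (n : OppGroup σ) (X : realNilradicalOpp σ) :
    HasDerivAt (fun t : ℝ => ℓ (toEnd σ (n * expN σ (t • X))))
      (ℓ (toEnd σ n * ad ℂ 𝔤 (X : 𝔤))) 0 := by
  set A := ad ℂ 𝔤 (X : 𝔤) with hA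
  have hnil : IsNilpotent A := isNilpotent_ad X.2.1
  let c : ℕ → F := fun k => ℓ (toEnd σ n * (((k.factorial : ℂ)⁻¹) • A ^ k))
  have h1 : (fun t : ℝ => ℓ (toEnd σ (n * expN σ (t • X)))) =
      fun t => ∑ k ∈ Finset.range (Module.finrank ℂ 𝔤 + 2), t ^ k • c k := by
    funext t
    have hnil' : IsNilpotent (t • A) := hnil.smul t
    rw [toEnd_mul_expN, nilExp_eq_sum hnil' (n := Module.finrank ℂ 𝔤 + 2) (by omega),
      Finset.mul_sum, map_sum]
    refine Finset.sum_congr rfl fun k _ => ?_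
    rw [smul_pow, smul_comm, mul_smul_comm, map_smul]
  rw [h1]
  have h2 : ∀ k ∈ Finset.range (Module.finrank ℂ 𝔤 + 2),
      HasDerivAt (fun t : ℝ => t ^ k • c k) ((k * (0 : ℝ) ^ (k - 1)) • c k) 0 :=
    fun k _ => (hasDerivAt_pow k (0 : ℝ)).smul_const (c k)
  -- At `t = 0` only the linear term has a nonzero derivative.
  refine (HasDerivAt.fun_sum h2).congr_deriv ?_
  rw [Finset.sum_eq_single 1]
  · simp [c]
  · intro k _ hk
    rcases k with _ | _ | k
    · simp
    · exact absurd rfl hk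
    · simp
  · intro h
    simp at h

/-- A smooth function on `N̄₀` is the restriction of a smooth function on the coordinate space of
`End 𝔤`. -/
lemma exists_contDiff {f : OppGroup σ → ℂ} (hf : f ∈ SmoothFun σ) :
    ∃ G : (Fin (Module.finrank ℝ (Module.End ℂ 𝔤)) → ℝ) → ℂ,
      ContDiff ℝ ∞ G ∧ ∀ n, f n = G (endCoord 𝔤 (toEnd σ n)) := by
  obtain ⟨F, hF, hfF⟩ := hf
  exact ⟨_, hF _ (endCoord 𝔤).symm.toLinearMap, fun n => by simp [hfF]⟩

/-- `R(X)` is the restriction to `N̄₀` of the linear vector field `v ↦ v ad X` on `End 𝔤`. -/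
lemma rightDeriv_eq_fderiv {f : OppGroup σ → ℂ}
    {G : (Fin (Module.finrank ℝ (Module.End ℂ 𝔤)) → ℝ) → ℂ} (hG : ContDiff ℝ ∞ G)
    (hf : ∀ n, f n = G (endCoord 𝔤 (toEnd σ n))) (X : realNilradicalOpp σ) (n : OppGroup σ) :
    rightDeriv σ X f n =
      fderiv ℝ G (endCoord 𝔤 (toEnd σ n)) (rightField (X : 𝔤) (endCoord 𝔤 (toEnd σ n))) := by
  have h1 := hasDerivAt_toEnd σ (endCoord 𝔤).toLinearMap n X
  have h0 : toEnd σ (n * expN σ ((0 : ℝ) • X)) = toEnd σ n := by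
    rw [toEnd_mul_expN, zero_smul, nilExp_eq_sum (IsNilpotent.zero) (Nat.le_succ _),
      Finset.sum_range_succ']
    simp
  have h2 : HasFDerivAt G (fderiv ℝ G (endCoord 𝔤 (toEnd σ n)))
      ((endCoord 𝔤).toLinearMap (toEnd σ (n * expN σ ((0 : ℝ) • X)))) := by
    rw [h0]
    exact (hG.differentiable (by simp) _).hasFDerivAt
  have h3 := h2.comp_hasDerivAt (0 : ℝ) h1
  rw [rightField_endCoord]
  refine HasDerivAt.deriv (h3.congr_of_eventuallyEq (Filter.Eventually.of_forall fun t => ?_))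
  exact hf _

/-- The vector fields of right differentiation satisfy `[R(X), R(Y)] = R([X, Y])`: the second
derivatives cancel by symmetry. -/
lemma rightDeriv_rightDeriv_sub {f : OppGroup σ → ℂ} (hf : f ∈ SmoothFun σ)
    (X Y Z : realNilradicalOpp σ) (hZ : (Z : 𝔤) = ⁅(X : 𝔤), (Y : 𝔤)⁆) (n : OppGroup σ) :
    rightDeriv σ X (rightDeriv σ Y f) n - rightDeriv σ Y (rightDeriv σ X f) n =
      rightDeriv σ Z f n := by
  obtain ⟨G, hG, hfG⟩ := exists_contDiff σ hf
  have hG' : ContDiff ℝ ∞ (fderiv ℝ G) := hG.fderiv_right (by simp)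
  have hsm : ∀ W : 𝔤, ContDiff ℝ ∞ fun v => fderiv ℝ G v (rightField W v) := fun W =>
    hG'.clm_apply (rightField W).contDiff
  have hd : ∀ (W : 𝔤) v u, fderiv ℝ (fun v => fderiv ℝ G v (rightField W v)) v u =
      fderiv ℝ (fderiv ℝ G) v u (rightField W v) + fderiv ℝ G v (rightField W u) := by
    intro W v u
    have h1 : HasFDerivAt (fderiv ℝ G) (fderiv ℝ (fderiv ℝ G) v) v :=
      (hG'.differentiable (by simp) v).hasFDerivAt
    have h2 : HasFDerivAt (rightField W) (rightField W) v := (rightField W).hasFDerivAt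
    rw [(h1.clm_apply h2).fderiv]
    simp [add_comm]
  have hsymm : ∀ v u w, fderiv ℝ (fderiv ℝ G) v u w = fderiv ℝ (fderiv ℝ G) v w u := by
    intro v u w
    exact ((contDiff_infty.mp hG 2).contDiffAt.isSymmSndFDerivAt (by simp)) u w
  rw [rightDeriv_eq_fderiv σ (hsm Y) (rightDeriv_eq_fderiv σ hG hfG Y) X n,
    rightDeriv_eq_fderiv σ (hsm X) (rightDeriv_eq_fderiv σ hG hfG X) Y n,
    rightDeriv_eq_fderiv σ hG hfG Z n, hd, hd, hsymm _ (rightField (Y : 𝔤) _)]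
  rw [add_sub_add_left_eq_sub, ← map_sub]
  congr 1
  simp only [rightField_endCoord, ← map_sub, hZ, LieHom.map_lie, Ring.lie_def, mul_sub, mul_assoc]

/-- The inclusion of `𝔫̄₀` in `𝔫̄`. -/
def ofReal : realNilradicalOpp σ →ₗ[ℝ] nilradicalOpp b i where
  toFun X := ⟨X, X.2.1⟩
  map_add' _ _ := rfl
  map_smul' _ _ := rfl

lemma rePart_ofReal (X : realNilradicalOpp σ) : rePart σ (ofReal σ X) = X := by
  refine Subtype.ext ?_
  change (2⁻¹ : ℝ) • ((X : 𝔤) + σ.conj X) = X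
  rw [X.2.2, ← two_smul ℝ (X : 𝔤), smul_smul]
  norm_num

lemma imPart_ofReal (X : realNilradicalOpp σ) : imPart σ (ofReal σ X) = 0 := by
  refine Subtype.ext ?_
  change (2⁻¹ : ℝ) • (-Complex.I • (X : 𝔤) + σ.conj (-Complex.I • (X : 𝔤))) = 0
  rw [map_smulₛₗ, X.2.2]
  simp

lemma imPart_I_smul (X : nilradicalOpp b i) : imPart σ (Complex.I • X) = rePart σ X := by
  change rePart σ (-Complex.I • Complex.I • X) = _
  rw [smul_smul]
  simp

lemma rePart_I_smul (X : nilradicalOpp b i) : rePart σ (Complex.I • X) = -imPart σ X := by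
  change _ = -rePart σ (-Complex.I • X)
  rw [← map_neg, neg_smul, neg_neg]

lemma eq_ofReal_add (X : nilradicalOpp b i) :
    X = ofReal σ (rePart σ X) + Complex.I • ofReal σ (imPart σ X) := by
  refine Subtype.ext ?_
  change (X : 𝔤) = (2⁻¹ : ℝ) • ((X : 𝔤) + σ.conj X) +
    Complex.I • (2⁻¹ : ℝ) • (-Complex.I • (X : 𝔤) + σ.conj (-Complex.I • (X : 𝔤)))
  rw [map_smulₛₗ]
  have h : ∀ Y : 𝔤, (2⁻¹ : ℝ) • Y = (2⁻¹ : ℂ) • Y := by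
    intro Y
    change (((2⁻¹ : ℝ) : ℂ)) • Y = _
    norm_num
  simp only [h, smul_add, smul_smul, map_neg, Complex.conj_I, neg_neg]
  rw [show Complex.I * (2⁻¹ * -Complex.I) = 2⁻¹ by linear_combination -(2⁻¹ : ℂ) * Complex.I_mul_I,
    show Complex.I * (2⁻¹ * Complex.I) = -2⁻¹ by linear_combination (2⁻¹ : ℂ) * Complex.I_mul_I]
  module

/-- A property of elements of `𝔫̄` that respects linear combinations may be checked on
`𝔫̄₀`. -/
lemma nilradicalOpp_induction {p : nilradicalOpp b i → Prop}
    (hreal : ∀ X : realNilradicalOpp σ, p (ofReal σ X)) (hadd : ∀ X Y, p X → p Y → p (X + Y))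
    (hsmul : ∀ (c : ℂ) X, p X → p (c • X)) (X : nilradicalOpp b i) : p X := by
  rw [eq_ofReal_add σ X]
  exact hadd _ _ (hreal _) (hsmul _ _ (hreal _))

lemma rightDeriv_add_dir {f : OppGroup σ → ℂ} (hf : f ∈ SmoothFun σ)
    (X Y : realNilradicalOpp σ) (n : OppGroup σ) :
    rightDeriv σ (X + Y) f n = rightDeriv σ X f n + rightDeriv σ Y f n := by
  obtain ⟨G, hG, hfG⟩ := exists_contDiff σ hf
  simp only [rightDeriv_eq_fderiv σ hG hfG, rightField_endCoord, ← map_add, ← mul_add]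
  rfl

lemma rightDeriv_smul_dir {f : OppGroup σ → ℂ} (hf : f ∈ SmoothFun σ) (r : ℝ)
    (X : realNilradicalOpp σ) (n : OppGroup σ) :
    rightDeriv σ (r • X) f n = r * rightDeriv σ X f n := by
  obtain ⟨G, hG, hfG⟩ := exists_contDiff σ hf
  simp only [rightDeriv_eq_fderiv σ hG hfG, rightField_endCoord]
  rw [← Complex.real_smul, ← map_smul, ← map_smul]
  congr 2
  ext Y
  change (toEnd σ n) ⁅(r : ℂ) • (X : 𝔤), Y⁆ = (r : ℂ) • (toEnd σ n) ⁅(X : 𝔤), Y⁆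
  rw [smul_lie, map_smul]

lemma R_apply (X : nilradicalOpp b i) (f : SmoothFun σ) (n : OppGroup σ) :
    (R σ X f : OppGroup σ → ℂ) n =
      rightDeriv σ (rePart σ X) f n + Complex.I * rightDeriv σ (imPart σ X) f n := rfl

/-- Right differentiation is `ℂ`-linear in the direction. -/
def RHom : nilradicalOpp b i →ₗ[ℂ] Op σ where
  toFun := R σ
  map_add' X Y := by
    refine LinearMap.ext fun f => Subtype.ext (funext fun n => ?_)
    change (R σ (X + Y) f : OppGroup σ → ℂ) n =
      (R σ X f : OppGroup σ → ℂ) n + (R σ Y f : OppGroup σ → ℂ) n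
    simp only [R_apply, map_add, rightDeriv_add_dir σ f.2]
    ring
  map_smul' c X := by
    refine LinearMap.ext fun f => Subtype.ext (funext fun n => ?_)
    change (R σ (c • X) f : OppGroup σ → ℂ) n = c * (R σ X f : OppGroup σ → ℂ) n
    have hc : c • X = c.re • X + c.im • (Complex.I • X) := by
      conv_lhs => rw [← Complex.re_add_im c, add_smul, mul_smul]
      rfl
    simp only [R_apply]
    rw [hc]
    simp only [map_add, map_smul, rePart_I_smul, imPart_I_smul]
    rw [← neg_one_smul ℝ (imPart σ X)]
    simp only [rightDeriv_add_dir σ f.2, rightDeriv_smul_dir σ f.2]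
    conv_rhs => rw [← Complex.re_add_im c]
    push_cast
    linear_combination (-(c.im : ℂ) * rightDeriv σ (imPart σ X) f n) * Complex.I_mul_I

lemma R_ofReal_apply (X : realNilradicalOpp σ) (f : SmoothFun σ) (n : OppGroup σ) :
    (R σ (ofReal σ X) f : OppGroup σ → ℂ) n = rightDeriv σ X f n := by
  have h0 : rightDeriv σ (0 : realNilradicalOpp σ) f n = 0 := by
    have := rightDeriv_smul_dir σ f.2 0 0 n
    simpa using this
  rw [R_apply, rePart_ofReal, imPart_ofReal, h0, mul_zero, add_zero]

lemma R_add (X Y : nilradicalOpp b i) : R σ (X + Y) = R σ X + R σ Y := map_add (RHom σ) X Y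

lemma R_smul (c : ℂ) (X : nilradicalOpp b i) : R σ (c • X) = c • R σ X := map_smul (RHom σ) c X

/-- Right differentiations are derivations. -/
lemma R_mul (X : nilradicalOpp b i) (f g : SmoothFun σ) :
    R σ X (f * g) = R σ X f * g + f * R σ X g := by
  induction X using nilradicalOpp_induction σ with
  | hreal X =>
    refine Subtype.ext (funext fun n => ?_)
    change (R σ (ofReal σ X) (f * g) : OppGroup σ → ℂ) n =
      (R σ (ofReal σ X) f : OppGroup σ → ℂ) n * (g : OppGroup σ → ℂ) n +
      (f : OppGroup σ → ℂ) n * (R σ (ofReal σ X) g : OppGroup σ → ℂ) n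
    simp only [R_ofReal_apply]
    have h := (hasDerivAt_of_rightDeriv σ f.2 X n).mul (hasDerivAt_of_rightDeriv σ g.2 X n)
    have h0 : n * expN σ ((0 : ℝ) • X) = n := by
      refine Subtype.ext (LinearEquiv.toLinearMap_injective ?_)
      change toEnd σ _ = toEnd σ n
      rw [toEnd_mul_expN, zero_smul, nilExp_eq_sum (IsNilpotent.zero) (Nat.le_succ _),
        Finset.sum_range_succ']
      simp
    rw [h0] at h
    exact h.deriv
  | hadd X Y hX hY =>
    simp only [R_add, LinearMap.add_apply, hX, hY]
    ring
  | hsmul c X hX =>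
    simp only [R_smul, LinearMap.smul_apply, hX, smul_add, smul_mul_assoc, mul_smul_comm]

lemma R_one (X : nilradicalOpp b i) : R σ X 1 = 0 := by
  have := R_mul σ X 1 1
  simpa using this

lemma lie_mem_nilradicalOpp {X Y : 𝔤} (hX : X ∈ nilradicalOpp b i) (hY : Y ∈ nilradicalOpp b i) :
    ⁅X, Y⁆ ∈ nilradicalOpp b i := by
  have h1 : ∀ j : {j : ℤ // j < 0}, ∀ A ∈ gr b i j, nilradicalOpp b i ≤
      (nilradicalOpp b i).comap (ad ℂ 𝔤 A) := by
    intro j A hA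
    refine iSup_le fun k B hB => ?_
    exact gr_le_nilradicalOpp (by have := j.2; have := k.2; omega) (lie_mem_gr hA hB)
  have h2 : nilradicalOpp b i ≤ (nilradicalOpp b i).comap (-ad ℂ 𝔤 Y) := by
    refine iSup_le fun j A hA => ?_
    rw [Submodule.mem_comap, LinearMap.neg_apply, ad_apply, lie_skew]
    exact h1 j A hA hY
  have h3 := h2 hX
  rwa [Submodule.mem_comap, LinearMap.neg_apply, ad_apply, lie_skew] at h3

/-- The bracket of `𝔫̄`. -/
def lieOpp (X Y : nilradicalOpp b i) : nilradicalOpp b i :=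
  ⟨⁅(X : 𝔤), (Y : 𝔤)⁆, lie_mem_nilradicalOpp X.2 Y.2⟩

/-- `[R(X), R(Y)] = R([X, Y])` for all `X, Y ∈ 𝔫̄`. -/
lemma R_mul_R_sub (X Y : nilradicalOpp b i) :
    R σ X * R σ Y - R σ Y * R σ X = R σ (lieOpp X Y) := by
  induction X using nilradicalOpp_induction σ with
  | hreal X =>
    induction Y using nilradicalOpp_induction σ with
    | hreal Y =>
      refine LinearMap.ext fun f => Subtype.ext (funext fun n => ?_)
      have hmem : ⁅(X : 𝔤), (Y : 𝔤)⁆ ∈ realNilradicalOpp σ :=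
        ⟨lie_mem_nilradicalOpp X.2.1 Y.2.1, by rw [σ.conj_lie, X.2.2, Y.2.2]⟩
      change (R σ (ofReal σ X) (R σ (ofReal σ Y) f) : OppGroup σ → ℂ) n -
        (R σ (ofReal σ Y) (R σ (ofReal σ X) f) : OppGroup σ → ℂ) n =
        (R σ (ofReal σ ⟨_, hmem⟩) f : OppGroup σ → ℂ) n
      have h1 : ∀ Z, (R σ (ofReal σ Z) f : OppGroup σ → ℂ) = rightDeriv σ Z f := fun Z =>
        funext fun n => R_ofReal_apply σ Z f n
      rw [R_ofReal_apply, R_ofReal_apply, R_ofReal_apply, h1, h1]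
      exact rightDeriv_rightDeriv_sub σ f.2 X Y ⟨_, hmem⟩ rfl n
    | hadd Y Z hY hZ =>
      have : lieOpp (ofReal σ X) (Y + Z) = lieOpp (ofReal σ X) Y + lieOpp (ofReal σ X) Z :=
        Subtype.ext (lie_add _ _ _)
      rw [this, R_add, R_add, ← hY, ← hZ]
      noncomm_ring
    | hsmul c Y hY =>
      have : lieOpp (ofReal σ X) (c • Y) = c • lieOpp (ofReal σ X) Y :=
        Subtype.ext (lie_smul _ _ _)
      rw [this, R_smul, R_smul, ← hY, mul_smul_comm, smul_mul_assoc]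
      exact LinearMap.ext fun f => (smul_sub c (_ : SmoothFun σ) _).symm
  | hadd X Z hX hZ =>
    have : lieOpp (X + Z) Y = lieOpp X Y + lieOpp Z Y := Subtype.ext (add_lie _ _ _)
    rw [this, R_add, R_add, ← hX, ← hZ]
    noncomm_ring
  | hsmul c X hX =>
    have : lieOpp (c • X) Y = c • lieOpp X Y := Subtype.ext (smul_lie _ _ _)
    rw [this, R_smul, R_smul, ← hX, mul_smul_comm, smul_mul_assoc]
    exact LinearMap.ext fun f => (smul_sub c (_ : SmoothFun σ) _).symm

/-- The restriction to `N̄₀` of a linear form on `End 𝔤`. -/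
def linFun (ℓ : Module.Dual ℂ (Module.End ℂ 𝔤)) : SmoothFun σ :=
  ⟨fun n => ℓ (toEnd σ n), ℓ, isSmooth_linear (ℓ.restrictScalars ℝ), fun _ => rfl⟩

/-- `R(Z)` maps the function `n̄ ↦ ℓ(n̄)` to `n̄ ↦ ℓ(n̄ ad Z)`. -/
lemma R_linFun_apply (Z : nilradicalOpp b i) (ℓ : Module.Dual ℂ (Module.End ℂ 𝔤))
    (n : OppGroup σ) : (R σ Z (linFun σ ℓ) : OppGroup σ → ℂ) n =
      ℓ (toEnd σ n * ad ℂ 𝔤 (Z : 𝔤)) := by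
  induction Z using nilradicalOpp_induction σ with
  | hreal X =>
    rw [R_ofReal_apply]
    exact (hasDerivAt_toEnd σ (ℓ.restrictScalars ℝ) n X).deriv
  | hadd X Y hX hY =>
    rw [R_add]
    change (R σ X (linFun σ ℓ) : OppGroup σ → ℂ) n + (R σ Y (linFun σ ℓ) : OppGroup σ → ℂ) n = _
    rw [hX, hY, Submodule.coe_add, map_add, mul_add, map_add]
  | hsmul c X hX =>
    rw [R_smul]
    change c * (R σ X (linFun σ ℓ) : OppGroup σ → ℂ) n = _
    rw [hX, Submodule.coe_smul, map_smul, mul_smul_comm, map_smul, smul_eq_mul]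

variable (𝔤) in
/-- The isomorphism of `𝔤` with its dual space given by the Killing form. -/
def killingDual : 𝔤 ≃ₗ[ℂ] Module.Dual ℂ 𝔤 :=
  LinearMap.BilinForm.toDual (killingForm ℂ 𝔤) (killingForm_nondegenerate ℂ 𝔤)

lemma killingForm_killingDual_symm (ℓ : Module.Dual ℂ 𝔤) (Y : 𝔤) :
    killingForm ℂ 𝔤 ((killingDual 𝔤).symm ℓ) Y = ℓ Y :=
  LinearMap.congr_fun ((killingDual 𝔤).apply_symm_apply ℓ) Y

/-- The matrix coefficient `n̄ ↦ ℓ(Ad(n̄⁻¹) Y)`. It is the restriction of a linear form on `End 𝔤`,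
since `κ(X, n̄⁻¹ Y) = κ(n̄ X, Y)`; this makes it smooth without differentiating the inverse. -/
def matrixCoeff (ℓ : Module.Dual ℂ 𝔤) (Y : 𝔤) : SmoothFun σ :=
  linFun σ ((killingForm ℂ 𝔤).flip Y ∘ₗ LinearMap.applyₗ ((killingDual 𝔤).symm ℓ))

lemma matrixCoeff_apply (ℓ : Module.Dual ℂ 𝔤) (Y : 𝔤) (n : OppGroup σ) :
    (matrixCoeff σ ℓ Y : OppGroup σ → ℂ) n = ℓ ((n : 𝔤 ≃ₗ[ℂ] 𝔤)⁻¹ Y) := by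
  rw [← killingForm_killingDual_symm, ← killingForm_apply_left]
  rfl

lemma R_matrixCoeff_apply (Z : nilradicalOpp b i) (ℓ : Module.Dual ℂ 𝔤) (Y : 𝔤) (n : OppGroup σ) :
    (R σ Z (matrixCoeff σ ℓ Y) : OppGroup σ → ℂ) n =
      -ℓ ⁅(Z : 𝔤), (n : 𝔤 ≃ₗ[ℂ] 𝔤)⁻¹ Y⁆ := by
  rw [matrixCoeff, R_linFun_apply, ← killingForm_killingDual_symm ℓ, ← killingForm_lie_left,
    ← killingForm_apply_left]
  rfl

end RightDifferentiation

/-! ### The action of `𝔤` on sections -/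

section Action

lemma nilExp_mem {E : Type*} [AddCommGroup E] [Module ℂ E] {A : Module.End ℂ E}
    {M : Submodule ℂ E} (hA : ∀ Y ∈ M, A Y ∈ M) {Y : E}
    (hY : Y ∈ M) : nilExp A Y ∈ M := by
  have hpow : ∀ k : ℕ, (A ^ k) Y ∈ M := by
    intro k
    induction k with
    | zero => simpa using hY
    | succ k ih => rw [pow_succ', Module.End.mul_apply]; exact hA _ ih
  rw [nilExp, LinearMap.sum_apply]
  exact sum_mem fun k _ => M.smul_mem _ (hpow k)

variable {𝔤 : Type*} [LieRing 𝔤] [LieAlgebra ℂ 𝔤] [FiniteDimensional ℂ 𝔤]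
  [LieAlgebra.IsKilling ℂ 𝔤] {H : LieSubalgebra ℂ 𝔤} [H.IsCartanSubalgebra]
variable {b : (rootSystem H).Base} {i : b.support} (σ : RealForm b i)

lemma projOpp_of_mem {Y : 𝔤} (hY : Y ∈ nilradicalOpp b i) : projOpp b i Y = ⟨Y, hY⟩ :=
  Submodule.projectionOnto_apply_of_mem_left _ hY

lemma projParabolic_of_mem {Y : 𝔤} (hY : Y ∈ nilradicalOpp b i) : projParabolic b i Y = 0 :=
  Submodule.projectionOnto_apply_of_mem_right _ hY

lemma projOpp_of_mem_parabolic {Y : 𝔤} (hY : Y ∈ parabolic b i) : projOpp b i Y = 0 :=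
  Submodule.projectionOnto_apply_of_mem_right _ hY

lemma projOpp_add_projParabolic (Y : 𝔤) :
    (projOpp b i Y : 𝔤) + projParabolic b i Y = Y := by
  obtain ⟨A, hA, B, hB, rfl⟩ := Submodule.mem_sup.mp
    ((isCompl_nilradicalOpp_parabolic b i).sup_eq_top ▸ Submodule.mem_top : Y ∈ _)
  have hB' : projParabolic b i B = ⟨B, hB⟩ := Submodule.projectionOnto_apply_of_mem_left _ hB
  rw [map_add, map_add, projOpp_of_mem hA, projOpp_of_mem_parabolic hB, projParabolic_of_mem hA,
    hB', add_zero, zero_add]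

/-- `𝔫̄` is stable under `N̄₀`. -/
lemma inv_apply_mem_nilradicalOpp (n : OppGroup σ) {Y : 𝔤} (hY : Y ∈ nilradicalOpp b i) :
    (n : 𝔤 ≃ₗ[ℂ] 𝔤)⁻¹ Y ∈ nilradicalOpp b i := by
  obtain ⟨n, hn⟩ := n
  have key : ∀ Y ∈ nilradicalOpp b i, n Y ∈ nilradicalOpp b i ∧ n⁻¹ Y ∈ nilradicalOpp b i := by
    induction hn using Subgroup.closure_induction with
    | mem g hg =>
      obtain ⟨Z, rfl⟩ := hg
      intro Y hY
      refine ⟨nilExp_mem (A := ad ℂ 𝔤 (Z : 𝔤)) (fun W hW => ?_) hY,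
        nilExp_mem (A := -ad ℂ 𝔤 (Z : 𝔤)) (fun W hW => neg_mem ?_) hY⟩
      · exact lie_mem_nilradicalOpp Z.2.1 hW
      · exact lie_mem_nilradicalOpp Z.2.1 hW
    | one => exact fun Y hY => ⟨hY, by simpa using hY⟩
    | mul g h _ _ hg hh =>
      intro Y hY
      refine ⟨(hg _ (hh Y hY).1).1, ?_⟩
      rw [mul_inv_rev, LinearEquiv.mul_apply]
      exact (hh _ (hg Y hY).2).2
    | inv g _ hg => exact fun Y hY => ⟨(hg Y hY).2, by simpa using (hg Y hY).1⟩
  exact (key Y hY).2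

/-- The extended weight is `κ(H_λ, ·)` with `H_λ ∈ 𝔥`, so it vanishes on `𝔫̄`. -/
lemma fundamentalWeightExt_of_mem {Y : 𝔤} (hY : Y ∈ nilradicalOpp b i) :
    fundamentalWeightExt b i Y = 0 := by
  have : nilradicalOpp b i ≤ LinearMap.ker (fundamentalWeightExt b i) := by
    refine iSup_le fun j Z hZ => ?_
    exact killingForm_eq_zero b i (by have := j.2; omega)
      (cartan_le_gr_zero ((cartanEquivDual H).symm (fundamentalWeight b i)).2) hZ
  exact this hY

lemma fundamentalWeightExt_projParabolic (Y : 𝔤) :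
    fundamentalWeightExt b i (projParabolic b i Y) = fundamentalWeightExt b i Y := by
  conv_rhs => rw [← projOpp_add_projParabolic (b := b) (i := i) Y, map_add,
    fundamentalWeightExt_of_mem (projOpp b i Y).2, zero_add]

lemma lineBundleAction_apply (s : ℂ) (Y : 𝔤) (f : SmoothFun σ) (n : OppGroup σ) :
    (lineBundleAction σ s Y f : OppGroup σ → ℂ) n =
      s * fundamentalWeightExt b i ((n : 𝔤 ≃ₗ[ℂ] 𝔤)⁻¹ Y) * (f : OppGroup σ → ℂ) n -
        (R σ (projOpp b i ((n : 𝔤 ≃ₗ[ℂ] 𝔤)⁻¹ Y)) f : OppGroup σ → ℂ) n := by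
  rw [← fundamentalWeightExt_projParabolic]
  rfl

/-- On `𝔫̄` the action does not depend on the bundle. -/
lemma lineBundleAction_eq_of_mem (s : ℂ) {Y : 𝔤} (hY : Y ∈ nilradicalOpp b i) :
    lineBundleAction σ s Y = lineBundleAction σ 0 Y := by
  refine LinearMap.ext fun f => Subtype.ext (funext fun n => ?_)
  rw [lineBundleAction_apply, lineBundleAction_apply,
    fundamentalWeightExt_of_mem (inv_apply_mem_nilradicalOpp σ n hY), mul_zero, mul_zero]

/-- On the trivial bundle `𝓛_0` every element of `𝔤` acts as a vector field. -/
lemma lineBundleAction_zero_mul (Y : 𝔤) (f g : SmoothFun σ) :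
    lineBundleAction σ 0 Y (f * g) =
      lineBundleAction σ 0 Y f * g + f * lineBundleAction σ 0 Y g := by
  refine Subtype.ext (funext fun n => ?_)
  change (lineBundleAction σ 0 Y (f * g) : OppGroup σ → ℂ) n =
    (lineBundleAction σ 0 Y f : OppGroup σ → ℂ) n * (g : OppGroup σ → ℂ) n +
    (f : OppGroup σ → ℂ) n * (lineBundleAction σ 0 Y g : OppGroup σ → ℂ) n
  simp only [lineBundleAction_apply, R_mul]
  change _ - ((R σ (projOpp b i ((n : 𝔤 ≃ₗ[ℂ] 𝔤)⁻¹ Y)) f : OppGroup σ → ℂ) n *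
    (g : OppGroup σ → ℂ) n + (f : OppGroup σ → ℂ) n *
    (R σ (projOpp b i ((n : 𝔤 ≃ₗ[ℂ] 𝔤)⁻¹ Y)) g : OppGroup σ → ℂ) n) = _
  ring

lemma lineBundleAction_one (s : ℂ) (Y : 𝔤) :
    lineBundleAction σ s Y 1 = s • matrixCoeff σ (fundamentalWeightExt b i) Y := by
  refine Subtype.ext (funext fun n => ?_)
  change (lineBundleAction σ s Y 1 : OppGroup σ → ℂ) n =
    s * (matrixCoeff σ (fundamentalWeightExt b i) Y : OppGroup σ → ℂ) n
  rw [lineBundleAction_apply, R_one, matrixCoeff_apply]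
  change _ * (1 : ℂ) - 0 = _
  ring

lemma R_sum {κ : Type*} (t : Finset κ) (c : κ → ℂ) (X : κ → nilradicalOpp b i) :
    R σ (∑ k ∈ t, c k • X k) = ∑ k ∈ t, c k • R σ (X k) := by
  have := map_sum (RHom σ) (fun k => c k • X k) t
  simp only [map_smul] at this
  exact this

lemma R_sum_apply {κ : Type*} (t : Finset κ) (c : κ → ℂ) (X : κ → nilradicalOpp b i)
    (f : SmoothFun σ) (n : OppGroup σ) :
    (R σ (∑ k ∈ t, c k • X k) f : OppGroup σ → ℂ) n =
      ∑ k ∈ t, c k * (R σ (X k) f : OppGroup σ → ℂ) n := by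
  rw [R_sum, LinearMap.sum_apply, AddSubmonoidClass.coe_finsetSum, Finset.sum_apply]
  rfl

/-- `π_0(Y) = -∑_a c_a R(E_a)` for a basis `E_a` of `𝔫̄`, where `c_a` is the coefficient of `E_a` in
`(Ad(n̄⁻¹) Y)_𝔫̄`. -/
lemma lineBundleAction_zero_eq (Y : 𝔤) :
    lineBundleAction σ 0 Y = -∑ a, mulOp (matrixCoeff σ
      ((Module.finBasis ℂ (nilradicalOpp b i)).coord a ∘ₗ projOpp b i) Y) *
        R σ (Module.finBasis ℂ (nilradicalOpp b i) a) := by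
  set B := Module.finBasis ℂ (nilradicalOpp b i)
  refine LinearMap.ext fun f => Subtype.ext (funext fun n => ?_)
  rw [lineBundleAction_apply, zero_mul, zero_mul, zero_sub]
  rw [LinearMap.neg_apply, LinearMap.sum_apply]
  change _ = -((∑ a, (mulOp (matrixCoeff σ (B.coord a ∘ₗ projOpp b i) Y) * R σ (B a)) f :
    SmoothFun σ) : OppGroup σ → ℂ) n
  rw [AddSubmonoidClass.coe_finsetSum, Finset.sum_apply]
  conv_lhs => rw [← B.sum_repr (projOpp b i ((n : 𝔤 ≃ₗ[ℂ] 𝔤)⁻¹ Y)), R_sum_apply]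
  congr 1
  refine Finset.sum_congr rfl fun a _ => ?_
  change _ = (matrixCoeff σ (B.coord a ∘ₗ projOpp b i) Y : OppGroup σ → ℂ) n *
    (R σ (B a) f : OppGroup σ → ℂ) n
  rw [matrixCoeff_apply]
  rfl

/-- The commutator of the action on functions with a right differentiation:
`[π_0(Y), R(Z)] = -R([Z, (Ad(n̄⁻¹) Y)_𝔮]_𝔫̄)`. -/
lemma comm_lineBundleAction_zero_R_apply (Y : 𝔤) (Z : nilradicalOpp b i) (f : SmoothFun σ)
    (n : OppGroup σ) :
    (comm (lineBundleAction σ 0 Y) (R σ Z) f : OppGroup σ → ℂ) n =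
      -(R σ (projOpp b i ⁅(Z : 𝔤), (projParabolic b i ((n : 𝔤 ≃ₗ[ℂ] 𝔤)⁻¹ Y) : 𝔤)⁆) f :
        OppGroup σ → ℂ) n := by
  set B := Module.finBasis ℂ (nilradicalOpp b i) with hB
  set y := (n : 𝔤 ≃ₗ[ℂ] 𝔤)⁻¹ Y with hy
  let c := fun a => matrixCoeff σ (B.coord a ∘ₗ projOpp b i) Y
  -- `[π_0(Y), R(Z)] = ∑_a (R(Z) c_a) R(E_a) + c_a R([Z, E_a])` for `π_0(Y) = -∑_a c_a R(E_a)`.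
  have h1 : comm (lineBundleAction σ 0 Y) (R σ Z) f =
      ∑ a, (R σ Z (c a) * R σ (B a) f + c a * R σ (lieOpp Z (B a)) f) := by
    have h2 : ∀ a, R σ Z (c a * R σ (B a) f) - c a * R σ (B a) (R σ Z f) =
        R σ Z (c a) * R σ (B a) f + c a * R σ (lieOpp Z (B a)) f := by
      intro a
      rw [R_mul, ← R_mul_R_sub σ Z (B a)]
      change _ = _ + c a * (R σ Z (R σ (B a) f) - R σ (B a) (R σ Z f))
      ring
    simp only [← h2, comm]
    rw [lineBundleAction_zero_eq, Finset.sum_sub_distrib, ← map_sum]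
    change -((∑ a, mulOp (c a) * R σ (B a)) (R σ Z f)) -
      R σ Z (-((∑ a, mulOp (c a) * R σ (B a)) f)) = _
    rw [LinearMap.sum_apply, LinearMap.sum_apply, map_neg, sub_neg_eq_add, neg_add_eq_sub]
    rfl
  have h3 : (comm (lineBundleAction σ 0 Y) (R σ Z) f : OppGroup σ → ℂ) n =
      ∑ a, (-(B.coord a (projOpp b i ⁅(Z : 𝔤), y⁆)) * (R σ (B a) f : OppGroup σ → ℂ) n +
        B.coord a (projOpp b i y) * (R σ (lieOpp Z (B a)) f : OppGroup σ → ℂ) n) := by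
    rw [h1, AddSubmonoidClass.coe_finsetSum, Finset.sum_apply]
    refine Finset.sum_congr rfl fun a _ => ?_
    change (R σ Z (c a) : OppGroup σ → ℂ) n * (R σ (B a) f : OppGroup σ → ℂ) n +
      (c a : OppGroup σ → ℂ) n * (R σ (lieOpp Z (B a)) f : OppGroup σ → ℂ) n = _
    simp only [c]
    rw [R_matrixCoeff_apply, matrixCoeff_apply]
    rfl
  have h4 : ∑ a, B.coord a (projOpp b i y) • lieOpp Z (B a) = lieOpp Z (projOpp b i y) := by
    refine Subtype.ext ?_
    change ((∑ a, B.coord a (projOpp b i y) • lieOpp Z (B a) : nilradicalOpp b i) : 𝔤) =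
      ⁅(Z : 𝔤), (projOpp b i y : 𝔤)⁆
    conv_rhs => rw [← B.sum_repr (projOpp b i y)]
    simp only [AddSubmonoidClass.coe_finsetSum, Submodule.coe_smul, lie_sum, lie_smul]
    rfl
  -- With `y = Ad(n̄⁻¹) Y` the two sums are `-R([Z, y]_𝔫̄)` and `R([Z, y_𝔫̄])`.
  have h5 : projOpp b i ⁅(Z : 𝔤), (projParabolic b i y : 𝔤)⁆ =
      projOpp b i ⁅(Z : 𝔤), y⁆ - lieOpp Z (projOpp b i y) := by
    have h6 : ⁅(Z : 𝔤), y⁆ = ⁅(Z : 𝔤), (projOpp b i y : 𝔤)⁆ +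
        ⁅(Z : 𝔤), (projParabolic b i y : 𝔤)⁆ := by
      rw [← lie_add, projOpp_add_projParabolic]
    have h7 : projOpp b i ⁅(Z : 𝔤), (projOpp b i y : 𝔤)⁆ = lieOpp Z (projOpp b i y) :=
      projOpp_of_mem (lieOpp Z (projOpp b i y)).2
    rw [h6, map_add, h7, add_sub_cancel_left]
  rw [h3, Finset.sum_add_distrib, ← R_sum_apply, ← R_sum_apply, h4, h5]
  have h8 : ∑ a, -(B.coord a (projOpp b i ⁅(Z : 𝔤), y⁆)) • B a =
      -projOpp b i ⁅(Z : 𝔤), y⁆ := by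
    simp only [neg_smul, Finset.sum_neg_distrib, Module.Basis.coord_apply, B.sum_repr]
  rw [h8]
  have h9 : R σ (-projOpp b i ⁅(Z : 𝔤), y⁆) = -R σ (projOpp b i ⁅(Z : 𝔤), y⁆) :=
    map_neg (RHom σ) _
  have h10 : R σ (projOpp b i ⁅(Z : 𝔤), y⁆ - lieOpp Z (projOpp b i y)) =
      R σ (projOpp b i ⁅(Z : 𝔤), y⁆) - R σ (lieOpp Z (projOpp b i y)) :=
    map_sub (RHom σ) _ _
  rw [h9, h10]
  change -(R σ (projOpp b i ⁅(Z : 𝔤), y⁆) f : OppGroup σ → ℂ) n +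
    (R σ (lieOpp Z (projOpp b i y)) f : OppGroup σ → ℂ) n =
    -((R σ (projOpp b i ⁅(Z : 𝔤), y⁆) f : OppGroup σ → ℂ) n -
      (R σ (lieOpp Z (projOpp b i y)) f : OppGroup σ → ℂ) n)
  ring

/-- `𝔫̄` acts by left translations, which commute with right differentiation: here
`Ad(n̄⁻¹) Y` has no component in `𝔮`. -/
lemma comm_lineBundleAction_R_of_mem (s : ℂ) {Y : 𝔤} (hY : Y ∈ nilradicalOpp b i)
    (Z : nilradicalOpp b i) : comm (lineBundleAction σ s Y) (R σ Z) = 0 := by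
  refine LinearMap.ext fun f => Subtype.ext (funext fun n => ?_)
  rw [lineBundleAction_eq_of_mem σ s hY, comm_lineBundleAction_zero_R_apply,
    projParabolic_of_mem (inv_apply_mem_nilradicalOpp σ n hY)]
  have h : R σ (0 : nilradicalOpp b i) = 0 := map_zero (RHom σ)
  simp [h]

end Action

/-! ### Equivalence of systems of differential operators -/

section Systems

variable {𝔤 : Type*} [LieRing 𝔤] [LieAlgebra ℂ 𝔤] [FiniteDimensional ℂ 𝔤]
  [LieAlgebra.IsKilling ℂ 𝔤] {H : LieSubalgebra ℂ 𝔤} [H.IsCartanSubalgebra]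
variable {b : (rootSystem H).Base} {i : b.support} {σ : RealForm b i}

/-- The list `∑ₖ A_{kj} D_k`. -/
def transformSystem {m : ℕ} (A : Matrix (Fin m) (Fin m) (SmoothFun σ)) (D : Fin m → Op σ) :
    Fin m → Op σ := fun j => ∑ k, mulOp (A k j) * D k

lemma transformSystem_apply {m : ℕ} (A : Matrix (Fin m) (Fin m) (SmoothFun σ)) (D : Fin m → Op σ)
    (j : Fin m) (f : SmoothFun σ) : transformSystem A D j f = ∑ k, A k j * D k f := by
  rw [transformSystem, LinearMap.sum_apply]
  rfl

lemma transformSystem_one {m : ℕ} (D : Fin m → Op σ) : transformSystem 1 D = D := by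
  refine funext fun j => LinearMap.ext fun f => ?_
  rw [transformSystem_apply]
  simp [Matrix.one_apply]

lemma transformSystem_mul {m : ℕ} (A B : Matrix (Fin m) (Fin m) (SmoothFun σ))
    (D : Fin m → Op σ) : transformSystem B (transformSystem A D) = transformSystem (A * B) D := by
  refine funext fun j => LinearMap.ext fun f => ?_
  simp only [transformSystem_apply, Matrix.mul_apply, Finset.mul_sum, Finset.sum_mul]
  rw [Finset.sum_comm]
  refine Finset.sum_congr rfl fun l _ => Finset.sum_congr rfl fun k _ => ?_
  ring

/-- An equivalence of systems in terms of mutually inverse matrices. -/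
lemma SystemEquiv.exists_transformSystem {m : ℕ} {D D' : Fin m → Op σ} (h : SystemEquiv D D') :
    ∃ A A' : Matrix (Fin m) (Fin m) (SmoothFun σ), A * A' = 1 ∧ A' * A = 1 ∧
      D' = transformSystem A D ∧ D = transformSystem A' D' := by
  obtain ⟨A, hA⟩ := h
  have h1 : D' = transformSystem (A : Matrix (Fin m) (Fin m) (SmoothFun σ)) D := funext hA
  refine ⟨A.val, A⁻¹.val, A.mul_inv, A.inv_mul, h1, ?_⟩
  rw [h1, transformSystem_mul, Units.mul_inv, transformSystem_one]

lemma SystemEquiv.refl {m : ℕ} (D : Fin m → Op σ) : SystemEquiv D D :=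
  ⟨1, fun j => (congrFun (transformSystem_one D) j).symm⟩

lemma SystemEquiv.trans {m : ℕ} {D D' D'' : Fin m → Op σ} (h : SystemEquiv D D')
    (h' : SystemEquiv D' D'') : SystemEquiv D D'' := by
  obtain ⟨A, hA⟩ := h
  obtain ⟨B, hB⟩ := h'
  refine ⟨A * B, fun j => ?_⟩
  have h1 : D' = transformSystem (A : Matrix (Fin m) (Fin m) (SmoothFun σ)) D := funext hA
  have h2 := hB j
  rw [h1] at h2
  rw [h2]
  exact congrFun (transformSystem_mul _ _ D) j

/-- `R(X)` is a differential operator of order `1`, because `[R(X), f] = R(X) f`. -/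
lemma isDiffOp_R (X : nilradicalOpp b i) : IsDiffOp (R σ X) := by
  refine ⟨1, fun f => ?_⟩
  have h : comm (R σ X) (mulOp f) = mulOp (R σ X f) := by
    refine LinearMap.ext fun g => ?_
    change R σ X (f * g) - f * R σ X g = R σ X f * g
    rw [R_mul, add_sub_cancel_right]
  rw [h]
  intro g
  refine LinearMap.ext fun u => ?_
  change R σ X f * (g * u) - g * (R σ X f * u) = 0
  ring

/-- Evaluation at a point, as a ring homomorphism. -/
def evalHom (p : OppGroup σ) : SmoothFun σ →+* ℂ :=
  (Pi.evalRingHom (fun _ : OppGroup σ => ℂ) p).comp (SmoothFun σ).val.toRingHom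

/-- Linear independence at a point is invariant under equivalence. -/
lemma SystemEquiv.linearIndependent {m : ℕ} {D D' : Fin m → Op σ} (h : SystemEquiv D D')
    (p : OppGroup σ) (hD : LinearIndependent ℂ fun j => evalAt p (D j)) :
    LinearIndependent ℂ fun j => evalAt p (D' j) := by
  obtain ⟨A, A', -, hA'A, rfl, -⟩ := h.exists_transformSystem
  rw [Fintype.linearIndependent_iff] at hD ⊢
  intro g hg
  let M : Matrix (Fin m) (Fin m) ℂ := A.map (evalHom p)
  have hM : A'.map (evalHom p) * M = 1 := by
    rw [← Matrix.map_mul, hA'A]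
    exact Matrix.map_one _ (map_zero _) (map_one _)
  have h1 : M.mulVec g = 0 := by
    refine funext fun k => hD (M.mulVec g) ?_ k
    rw [← hg]
    refine LinearMap.ext fun f => ?_
    have h2 : ∀ j, evalAt p (transformSystem A D j) f =
        ∑ k, M k j * evalAt p (D k) f := by
      intro j
      change evalHom p (transformSystem _ D j f) = _
      rw [transformSystem_apply, map_sum]
      simp only [map_mul]
      rfl
    simp only [LinearMap.sum_apply, LinearMap.smul_apply, h2, smul_eq_mul, Matrix.mulVec,
      dotProduct, Finset.sum_mul, Finset.mul_sum]
    rw [Finset.sum_comm]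
    refine Finset.sum_congr rfl fun l _ => Finset.sum_congr rfl fun k _ => ?_
    ring
  have h2 : g = 0 := by
    rw [← Matrix.one_mulVec g, ← hM, ← Matrix.mulVec_mulVec, h1, Matrix.mulVec_zero]
  exact fun k => congrFun h2 k

/-- The existence of structure operators for a derivation `P` is invariant under equivalence. -/
lemma SystemEquiv.exists_structure {m : ℕ} {D D' : Fin m → Op σ} (h : SystemEquiv D D') (P : Op σ)
    (hP : ∀ f g, P (f * g) = P f * g + f * P g)
    (hD : ∃ C : Matrix (Fin m) (Fin m) (SmoothFun σ), ∀ j, comm P (D j) = transformSystem C D j) :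
    ∃ C : Matrix (Fin m) (Fin m) (SmoothFun σ), ∀ j, comm P (D' j) = transformSystem C D' j := by
  obtain ⟨A, A', -, -, h1, h2⟩ := h.exists_transformSystem
  obtain ⟨C, hC⟩ := hD
  -- `[P, ∑ A D] = ∑ (P A) D + ∑ A [P, D]`, and `D` is a combination of the transformed list.
  let B : Matrix (Fin m) (Fin m) (SmoothFun σ) := A.map P + C * A
  have h3 : ∀ j, comm P (D' j) = transformSystem B D j := by
    intro j
    refine LinearMap.ext fun f => ?_
    have h4 : ∀ k, P (D k f) - D k (P f) = transformSystem C D k f := fun k => by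
      rw [← hC k]; rfl
    change P (D' j f) - D' j (P f) = _
    have h5 : transformSystem B D j f = ∑ k, P (A k j) * D k f +
        transformSystem A (transformSystem C D) j f := by
      rw [transformSystem_mul]
      simp only [transformSystem_apply, B, Matrix.add_apply, Matrix.map_apply, add_mul,
        Finset.sum_add_distrib]
    rw [h5, h1]
    simp only [transformSystem_apply A, ← h4, map_sum, hP, mul_sub,
      Finset.sum_add_distrib, Finset.sum_sub_distrib]
    abel
  refine ⟨A' * B, fun j => ?_⟩
  rw [h3, ← transformSystem_mul, ← h2]

end Systems

/-! ### The systems of right differentiations along bases of `𝔤(-1)` -/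

section RightSystem

variable {𝔤 : Type*} [LieRing 𝔤] [LieAlgebra ℂ 𝔤] [FiniteDimensional ℂ 𝔤]
  [LieAlgebra.IsKilling ℂ 𝔤] {H : LieSubalgebra ℂ 𝔤} [H.IsCartanSubalgebra]
variable {b : (rootSystem H).Base} {i : b.support} (σ : RealForm b i)

lemma R_inclOpp_sum {m : ℕ} (c : Fin m → ℂ) (X : Fin m → grMod b i (-1)) :
    R σ (inclOpp b i (∑ k, c k • X k)) = ∑ k, c k • R σ (inclOpp b i (X k)) := by
  rw [← R_sum]
  congr 1
  refine Subtype.ext ?_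
  change ((∑ k, c k • X k : grMod b i (-1)) : 𝔤) =
    ((∑ k, c k • inclOpp b i (X k) : nilradicalOpp b i) : 𝔤)
  simp only [AddSubmonoidClass.coe_finsetSum]
  rfl

/-- Two bases of `𝔤(-1)` give equivalent systems of right differentiations. -/
lemma systemEquiv_of_basis {m : ℕ} (x y : Module.Basis (Fin m) ℂ (grMod b i (-1))) :
    SystemEquiv (fun j => R σ (inclOpp b i (x j))) fun j => R σ (inclOpp b i (y j)) := by
  let A : GL (Fin m) ℂ := ⟨x.toMatrix y, y.toMatrix x, x.toMatrix_mul_toMatrix_flip y,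
    y.toMatrix_mul_toMatrix_flip x⟩
  refine ⟨Matrix.GeneralLinearGroup.map (algebraMap ℂ (SmoothFun σ)) A, fun j => ?_⟩
  change R σ (inclOpp b i (y j)) = _
  conv_lhs => rw [← x.sum_repr (y j)]
  rw [R_inclOpp_sum]
  refine Finset.sum_congr rfl fun k _ => LinearMap.ext fun f => ?_
  change x.repr (y j) k • _ = algebraMap ℂ (SmoothFun σ) (x.repr (y j) k) * _
  rw [Algebra.smul_def]

/-- The right differentiations along a basis of `𝔤(-1)` are linearly independent at each point: they
are told apart by the linear functions on `End 𝔤`, because `ad` is injective. -/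
lemma linearIndependent_evalAt_R {m : ℕ} (x : Module.Basis (Fin m) ℂ (grMod b i (-1)))
    (p : OppGroup σ) :
    LinearIndependent ℂ fun j => evalAt p (R σ (inclOpp b i (x j))) := by
  rw [Fintype.linearIndependent_iff]
  intro g hg
  set Z := ∑ j, g j • x j with hZ
  have h1 : ∀ f : SmoothFun σ, (R σ (inclOpp b i Z) f : OppGroup σ → ℂ) p = 0 := by
    intro f
    have h2 := LinearMap.congr_fun hg f
    rw [LinearMap.sum_apply, LinearMap.zero_apply] at h2
    rw [hZ, R_inclOpp_sum, ← h2, LinearMap.sum_apply, AddSubmonoidClass.coe_finsetSum,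
      Finset.sum_apply]
    rfl
  have h3 : toEnd σ p * ad ℂ 𝔤 (Z : 𝔤) = 0 := by
    rw [← Module.forall_dual_apply_eq_zero_iff ℂ]
    intro ℓ
    have := h1 (linFun σ ℓ)
    rwa [R_linFun_apply] at this
  have h4 : ∀ Y : 𝔤, ⁅(Z : 𝔤), Y⁆ = 0 := by
    intro Y
    have h5 : (p : 𝔤 ≃ₗ[ℂ] 𝔤) ⁅(Z : 𝔤), Y⁆ = 0 := LinearMap.congr_fun h3 Y
    simpa using h5
  have h6 : Z = 0 := by
    refine Subtype.ext (eq_zero_of_killingForm b i Z.2 fun Y _ => ?_)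
    have h7 : ad ℂ 𝔤 (Z : 𝔤) = 0 := LinearMap.ext h4
    rw [killingForm_apply_apply, h7]
    simp
  have h8 := (Fintype.linearIndependent_iff.mp x.linearIndependent) g (hZ.symm.trans h6)
  exact h8

/-- If `Z ∈ 𝔤(-1)`, then `[Z, y_𝔮]_𝔫̄ ∈ 𝔤(-1)`: only the component of `y` in `𝔩` contributes,
because `[𝔤(-1), 𝔫] ⊆ 𝔮`. -/
lemma projOpp_lie_projParabolic_mem (Z : grMod b i (-1)) (y : 𝔤) :
    (projOpp b i ⁅(Z : 𝔤), (projParabolic b i y : 𝔤)⁆ : 𝔤) ∈ gr b i (-1) := by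
  have h : parabolic b i ≤ (gr b i (-1)).comap
      ((nilradicalOpp b i).subtype ∘ₗ projOpp b i ∘ₗ (ad ℂ 𝔤 (Z : 𝔤) : 𝔤 →ₗ[ℂ] 𝔤)) := by
    refine sup_le (fun Y hY => ?_) (iSup_le fun j Y hY => ?_)
    · change (projOpp b i ⁅(Z : 𝔤), Y⁆ : 𝔤) ∈ gr b i (-1)
      have h1 : ⁅(Z : 𝔤), Y⁆ ∈ gr b i (-1) := by simpa using lie_mem_gr Z.2 hY
      rwa [projOpp_of_mem (gr_le_nilradicalOpp (by norm_num) h1)]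
    · change (projOpp b i ⁅(Z : 𝔤), Y⁆ : 𝔤) ∈ gr b i (-1)
      have h1 : ⁅(Z : 𝔤), Y⁆ ∈ parabolic b i :=
        gr_le_parabolic (by have := j.2; omega) (lie_mem_gr Z.2 hY)
      rw [projOpp_of_mem_parabolic h1]
      exact zero_mem _
  exact h (projParabolic b i y).2

/-- The linear map `y ↦ [Z, y_𝔮]_𝔫̄` from `𝔤` to `𝔤(-1)`, for `Z ∈ 𝔤(-1)`. -/
def structureMap (Z : grMod b i (-1)) : 𝔤 →ₗ[ℂ] grMod b i (-1) :=
  ((nilradicalOpp b i).subtype ∘ₗ projOpp b i ∘ₗ (ad ℂ 𝔤 (Z : 𝔤) : 𝔤 →ₗ[ℂ] 𝔤) ∘ₗ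
    (parabolic b i).subtype ∘ₗ projParabolic b i).codRestrict (gr b i (-1))
    (projOpp_lie_projParabolic_mem Z)

lemma inclOpp_structureMap (Z : grMod b i (-1)) (y : 𝔤) :
    inclOpp b i (structureMap Z y) = projOpp b i ⁅(Z : 𝔤), (projParabolic b i y : 𝔤)⁆ := rfl

/-- The structure operators of the right differentiations along a basis of `𝔤(-1)` on `𝓛_0`: the
coefficients of `[Z, (Ad(n̄⁻¹) Y)_𝔮]_𝔫̄` in the basis. -/
lemma exists_structure_R {m : ℕ} (x : Module.Basis (Fin m) ℂ (grMod b i (-1))) (Y : 𝔤) :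
    ∃ C : Matrix (Fin m) (Fin m) (SmoothFun σ), ∀ j,
      comm (lineBundleAction σ 0 Y) (R σ (inclOpp b i (x j))) =
        transformSystem C (fun j => R σ (inclOpp b i (x j))) j := by
  refine ⟨Matrix.of fun k j => -matrixCoeff σ (x.coord k ∘ₗ structureMap (x j)) Y, fun j => ?_⟩
  refine LinearMap.ext fun f => Subtype.ext (funext fun n => ?_)
  rw [comm_lineBundleAction_zero_R_apply, transformSystem_apply, AddSubmonoidClass.coe_finsetSum,
    Finset.sum_apply]
  have h1 := inclOpp_structureMap (x j) ((n : 𝔤 ≃ₗ[ℂ] 𝔤)⁻¹ Y)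
  change -(R σ (projOpp b i ⁅(x j : 𝔤), _⁆) f : OppGroup σ → ℂ) n = ∑ k,
    -(matrixCoeff σ (x.coord k ∘ₗ structureMap (x j)) Y : OppGroup σ → ℂ) n *
      (R σ (inclOpp b i (x k)) f : OppGroup σ → ℂ) n
  rw [← h1, ← x.sum_repr (structureMap (x j) _), R_inclOpp_sum, LinearMap.sum_apply,
    AddSubmonoidClass.coe_finsetSum, Finset.sum_apply, ← Finset.sum_neg_distrib]
  refine Finset.sum_congr rfl fun k _ => ?_
  rw [matrixCoeff_apply, neg_mul]
  rfl

/-- `α_q(H_λ) ≠ 0` for the element `H_λ` representing the fundamental weight `λ_q`. -/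
lemma root_apply_fundamentalWeight_ne_zero :
    (i.1.1 : Weight ℂ H 𝔤) ((cartanEquivDual H).symm (fundamentalWeight b i)) ≠ 0 := by
  intro h0
  have h1 := traceForm_coroot (i.1.1 : Weight ℂ H 𝔤)
    ((cartanEquivDual H).symm (fundamentalWeight b i))
  rw [h0, traceForm_comm] at h1
  have h2 : cartanEquivDual H ((cartanEquivDual H).symm (fundamentalWeight b i))
      (coroot (i.1.1 : Weight ℂ H 𝔤)) = 1 := by
    rw [LinearEquiv.apply_symm_apply, fundamentalWeight]
    change b.toCoweightBasis.coord i ((rootSystem H).coroot i) = 1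
    rw [Module.Basis.coord_apply, b.toCoweightBasis_repr_coroot, Finsupp.single_eq_same]
  change traceForm ℂ H 𝔤 _ _ = 1 at h2
  rw [h2] at h1
  simp at h1

/-- A conformally invariant system equivalent to the right differentiations along `𝔤(-1)` exists
only on the trivial bundle: it annihilates `1`, hence also `π_s(Y) 1`, which is `s` times the matrix
coefficient of the extended fundamental weight. -/
lemma eq_zero_of_isConformallyInvariantSystem {m : ℕ} {s : ℂ}
    (x : Module.Basis (Fin m) ℂ (grMod b i (-1))) {D : Fin m → Op σ}
    (hD : SystemEquiv (fun j => R σ (inclOpp b i (x j))) D)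
    (h : IsConformallyInvariantSystem s D) : s = 0 := by
  obtain ⟨A, A', -, -, h1, h2⟩ := hD.exists_transformSystem
  have hone : ∀ j, D j 1 = 0 := by
    intro j
    rw [h1, transformSystem_apply]
    simp [R_one]
  have hD0 : ∀ (Y : 𝔤) j, D j (lineBundleAction σ s Y 1) = 0 := by
    intro Y j
    obtain ⟨C, hC⟩ := h.exists_structure_operator Y
    have h3 : (comm (lineBundleAction σ s Y) (D j)) 1 = transformSystem C D j 1 :=
      LinearMap.congr_fun (hC j) 1
    rw [transformSystem_apply] at h3
    change lineBundleAction σ s Y (D j 1) - D j (lineBundleAction σ s Y 1) = _ at h3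
    simpa [hone] using h3
  have hR0 : ∀ (Y : 𝔤) j, s * fundamentalWeightExt b i ⁅(x j : 𝔤), Y⁆ = 0 := by
    intro Y j
    have h3 : R σ (inclOpp b i (x j)) (lineBundleAction σ s Y 1) = 0 := by
      have h4 := LinearMap.congr_fun (congrFun h2 j) (lineBundleAction σ s Y 1)
      rw [transformSystem_apply] at h4
      simpa [hD0] using h4
    rw [lineBundleAction_one, map_smul] at h3
    -- Evaluation at the identity suffices.
    have h4 := congrFun (congrArg Subtype.val h3) 1
    change s * (R σ (inclOpp b i (x j)) (matrixCoeff σ _ Y) : OppGroup σ → ℂ) 1 = 0 at h4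
    rw [R_matrixCoeff_apply] at h4
    change s * -fundamentalWeightExt b i ⁅(x j : 𝔤), (1 : 𝔤 ≃ₗ[ℂ] 𝔤)⁻¹ Y⁆ = 0 at h4
    rw [inv_one, LinearEquiv.coe_one, id] at h4
    linear_combination -h4
  have hZ0 : ∀ (Z : grMod b i (-1)) (Y : 𝔤), s * fundamentalWeightExt b i ⁅(Z : 𝔤), Y⁆ = 0 := by
    intro Z Y
    let φ : grMod b i (-1) →ₗ[ℂ] ℂ := s • (fundamentalWeightExt b i ∘ₗ
      (-(ad ℂ 𝔤 Y : 𝔤 →ₗ[ℂ] 𝔤)) ∘ₗ (grMod b i (-1)).toSubmodule.subtype)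
    have hφ : ∀ Z : grMod b i (-1), φ Z = s * fundamentalWeightExt b i ⁅(Z : 𝔤), Y⁆ := by
      intro Z
      change s * fundamentalWeightExt b i (-⁅Y, (Z : 𝔤)⁆) = _
      rw [lie_skew]
    have h3 : φ = 0 := x.ext fun j => by rw [hφ, hR0]; rfl
    rw [← hφ, h3]
    rfl
  -- A root vector `z` for `-α_q` satisfies `κ(H_λ, [z, Y]) = κ([H_λ, z], Y) = -α_q(H_λ) κ(z, Y)`.
  by_contra hs
  obtain ⟨z, hz, hz0⟩ := (-(i.1.1 : Weight ℂ H 𝔤)).exists_ne_zero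
  have hmem : z ∈ gr b i (-1) := by
    refine rootSpace_le_gr ?_ hz
    have := root_apply_gradingElement (b := b) (i := i) i
    simpa using this
  refine hz0 ((killingForm_nondegenerate ℂ 𝔤).1 z fun Y => ?_)
  have h3 := (mul_eq_zero.mp (hZ0 ⟨z, hmem⟩ Y)).resolve_left hs
  rw [fundamentalWeightExt, ← traceForm_apply_lie_apply] at h3
  have h4 := lie_eq_smul_of_mem_rootSpace hz ((cartanEquivDual H).symm (fundamentalWeight b i))
  change ⁅(((cartanEquivDual H).symm (fundamentalWeight b i) : H) : 𝔤), z⁆ = _ at h4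
  rw [h4, map_smul, LinearMap.smul_apply, smul_eq_mul] at h3
  refine (mul_eq_zero.mp h3).resolve_left ?_
  simpa using root_apply_fundamentalWeight_ne_zero (b := b) (i := i)

end RightSystem

end OmegaOne
end
open OmegaOne

/-- Let `𝔤` be a complex simple Lie algebra and `𝔮` the maximal parabolic subalgebra of a simple
root `i`, of quasi-Heisenberg type. For an enumeration `α` of `Δ(𝔤(1))` and root vectors `x j` of the
roots `-α j`, the operators `R(x j)` form an `Ω₁` system; every `Ω₁` system on `𝓛_s` is equivalent to
it, and is conformally invariant on `𝓛_s` if and only if `s = 0`. -/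
theorem theorem8p1p2 {𝔤 : Type*} [LieRing 𝔤] [LieAlgebra ℂ 𝔤] [FiniteDimensional ℂ 𝔤]
    [LieAlgebra.IsSimple ℂ 𝔤] (H : LieSubalgebra ℂ 𝔤) [H.IsCartanSubalgebra]
    (b : (LieAlgebra.IsKilling.rootSystem H).Base) (i : b.support)
    (hq : OmegaOne.IsQuasiHeisenberg b i) (σ : OmegaOne.RealForm b i)
    {m : ℕ} (α : Fin m ≃ OmegaOne.DeltaOne b i) (x : Fin m → OmegaOne.grMod b i (-1))
    (hx : ∀ j, (x j : 𝔤) ∈ LieAlgebra.rootSpace H (-((α j).1 : H → ℂ))) (hx0 : ∀ j, x j ≠ 0)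
    (s : ℂ) :
    OmegaOne.IsOmegaOneSystem σ s (fun j => OmegaOne.R σ (OmegaOne.inclOpp b i (x j))) ∧
    ∀ (n : ℕ) (D : Fin n → OmegaOne.Op σ), OmegaOne.IsOmegaOneSystem σ s D →
      (∃ h : n = m, OmegaOne.SystemEquiv
        (fun j => OmegaOne.R σ (OmegaOne.inclOpp b i (x (Fin.cast h j)))) D) ∧
      (OmegaOne.IsConformallyInvariantSystem s D ↔ s = 0) := by
  let B := rootVectorBasis α x hx hx0
  have hB : ∀ j, B j = x j := fun j => Module.Basis.mk_apply _ _ j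
  refine ⟨⟨fun j => ⟨isDiffOp_R _, fun X hX => comm_lineBundleAction_R_of_mem σ s hX _⟩, ?_⟩, ?_⟩
  · obtain ⟨V, hV, hne⟩ := exists_isIrreducible_tauTildeOne_ne_zero hq
    refine ⟨V, hV, hne, B.map (omegaEquiv V hV hne).symm, ?_⟩
    have h : (fun j => Omega σ (B.map (omegaEquiv V hV hne).symm j : V)) =
        fun j => R σ (inclOpp b i (x j)) := by
      funext j
      change R σ (inclOpp b i (omegaEquiv V hV hne ((omegaEquiv V hV hne).symm (B j)))) = _
      rw [LinearEquiv.apply_symm_apply, hB]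
    rw [h]
    exact SystemEquiv.refl _
  · rintro n D ⟨hD, V, hV, hne, Y, hYD⟩
    let B' := Y.map (omegaEquiv V hV hne)
    have hnm : n = m := by
      have h1 := Module.finrank_eq_card_basis B
      have h2 := Module.finrank_eq_card_basis B'
      simpa using h2.symm.trans h1
    subst hnm
    have hequiv : SystemEquiv (fun j => R σ (inclOpp b i (B j))) D :=
      (systemEquiv_of_basis σ B B').trans hYD
    refine ⟨⟨rfl, ?_⟩, eq_zero_of_isConformallyInvariantSystem σ B hequiv, ?_⟩
    · simp only [hB] at hequiv
      exact hequiv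
    · rintro rfl
      refine ⟨fun j => (hD j).1, fun p =>
        hequiv.linearIndependent p (linearIndependent_evalAt_R σ B p), fun Z => ?_⟩
      exact hequiv.exists_structure _ (lineBundleAction_zero_mul σ Z) (exists_structure_R σ B Z)
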